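/- For a distribution $\mathcal D$ on $[0,1]\times\{0,1\}$ (pairs $(v,y)$ of a prediction and a binary outcome), the lower distance to calibration is $\underline{\mathsf{dCE}}(\mathcal D):=\inf_{\Pi}\mathbb E_{(u,v,y)\sim\Pi}|u-v|$, where $\Pi$ ranges over the distributions of $(u,v,y)\in[0,1]\times[0,1]\times\{0,1\}$ such that $(v,y)$ has law $\mathcal D$ and $\mathbb E_\Pi[y\mid u]=u$ almost surely. An algorithm solves the $(\varepsilon_1,\varepsilon_2)$-tolerant calibration testing problem with $n$ samples if, for every distribution $\mathcal D$ on $[0,1]\times\{0,1\}$, given $n$ i.i.d. draws from $\mathcal D$, it returns "yes" or "no" and, with probability at least $\frac23$, it returns "no" if $\underline{\mathsf{dCE}}(\mathcal D)\ge\varepsilon_1$ and "yes" if $\underline{\mathsf{dCE}}(\mathcal D)\le\varepsilon_2$. **Theorem.** There are universal constants $C,K>0$ and a single (deterministic) real-RAM program such that the following holds for all reals $0\le\varepsilon_2\le\varepsilon_1\le1$ with $\varepsilon_1>4\varepsilon_2$ and all $n\in\mathbb N$ with $n\ge C/(\varepsilon_1-4\varepsilon_2)^2$. On the input $\varepsilon_1,\varepsilon_2,n$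 and $n$ samples, the program halts on every sample sequence in $([0,1]\times\{0,1\})^n$ after at most $K\,n\log^2(n)$ steps with the answer "yes" or "no", and it solves the $(\varepsilon_1,\varepsilon_2)$-tolerant calibration testing problem with $n$ samples. -/

import Mathlib

open MeasureTheory

namespace CalibrationTesting

/-! ### Distributions of prediction-outcome pairs and the lower distance to calibration -/

/-- A prediction in `[0,1]` together with a binary outcome (`true` is `1`, `false` is `0`). -/
abbrev Sample : Type := unitInterval × Bool

/-- The joint law `μ` of `(u, y)` is perfectly calibrated: `𝔼[y | u] = u` almost surely. -/
def Calibrated (μ : Measure Sample) : Prop :=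
  μ[(fun p : Sample => (p.2.toNat : ℝ)) |
      MeasurableSpace.comap (Prod.fst : Sample → unitInterval) inferInstance]
    =ᵐ[μ] fun p : Sample => (p.1 : ℝ)

/-- `ext D`: the laws of triples `(u, v, y)` such that `(v, y)` has law `D` and the law of
`(u, y)` is perfectly calibrated. -/
def ext (D : Measure Sample) : Set (Measure (unitInterval × unitInterval × Bool)) :=
  {Q | IsProbabilityMeasure Q ∧
    Q.map (fun q => (q.2.1, q.2.2)) = D ∧
    Calibrated (Q.map (fun q => (q.1, q.2.2)))}

/-- The lower distance to calibration: the infimum of `𝔼|u - v|` over `ext D`. -/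
noncomputable def dCE (D : Measure Sample) : ℝ :=
  sInf ((fun Q : Measure (unitInterval × unitInterval × Bool) =>
    ∫ q, |(q.1 : ℝ) - (q.2.1 : ℝ)| ∂Q) '' ext D)

/-- The decision rule `A` (`true` is "yes", `false` is "no") solves the `(ε₁, ε₂)`-tolerant
calibration testing problem with `n` samples: for every distribution `D`, with probability at
least `2/3` over `n` i.i.d. draws from `D`, it answers "no" if `dCE D ≥ ε₁`
and "yes" if `dCE D ≤ ε₂`. -/
def SolvesTolerantTesting (ε₁ ε₂ : ℝ) (n : ℕ) (A : (Fin n → Sample) → Bool) : Prop :=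
  ∀ D : Measure Sample, ∀ _ : IsProbabilityMeasure D,
    ∃ E : Set (Fin n → Sample), MeasurableSet E ∧
      2 / 3 ≤ (Measure.pi fun _ : Fin n => D).real E ∧
      ∀ s ∈ E, (ε₁ ≤ dCE D → A s = false) ∧ (dCE D ≤ ε₂ → A s = true)

/-! ### A real RAM with a step count

Programs are finite while-programs over registers and arrays that hold either natural numbers
(used as indices) or exact real numbers. Arrays are addressed by computed indices (random access).
The real operations are `+`, `-`, `*`, `/` and comparison; there is no rounding and no other way
from reals to integers. The integer operations are `+`, truncated `-`, halving and comparison.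
Every operation, constant, memory access, test and assignment costs one step. -/

/-- A memory state. All registers and arrays are named by natural numbers; a program mentions
only finitely many of the names. -/
structure Store where
  /-- integer registers -/
  nreg : ℕ → ℕ
  /-- real registers -/
  rreg : ℕ → ℝ
  /-- integer arrays: name, then index -/
  narr : ℕ → ℕ → ℕ
  /-- real arrays: name, then index -/
  rarr : ℕ → ℕ → ℝ

/-- Integer expressions. -/
inductive NExp : Type
  | const (k : ℕ)
  | reg (x : ℕ)
  | arr (a : ℕ) (i : NExp)
  | add (e f : NExp)
  | sub (e f : NExp)
  | half (e : NExp)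

/-- Real expressions. The constants in a program are rational. -/
inductive RExp : Type
  | const (q : ℚ)
  | reg (x : ℕ)
  | arr (a : ℕ) (i : NExp)
  | cast (e : NExp)
  | add (e f : RExp)
  | sub (e f : RExp)
  | mul (e f : RExp)
  | div (e f : RExp)

/-- Tests. -/
inductive BExp : Type
  | nle (e f : NExp)
  | rle (e f : RExp)
  | not (b : BExp)
  | and (b c : BExp)

/-- Programs. -/
inductive Prog : Type
  | skip
  | setN (x : ℕ) (e : NExp)
  | setR (x : ℕ) (e : RExp)
  | storeN (a : ℕ) (i : NExp) (e : NExp)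
  | storeR (a : ℕ) (i : NExp) (e : RExp)
  | seq (c d : Prog)
  | ite (b : BExp) (c d : Prog)
  | loop (b : BExp) (c : Prog)

/-- The value of an integer expression. -/
def NExp.eval (σ : Store) : NExp → ℕ
  | .const k => k
  | .reg x => σ.nreg x
  | .arr a i => σ.narr a (i.eval σ)
  | .add e f => e.eval σ + f.eval σ
  | .sub e f => e.eval σ - f.eval σ
  | .half e => e.eval σ / 2

/-- The number of steps taken to evaluate an integer expression. -/
def NExp.cost : NExp → ℕ
  | .const _ => 1
  | .reg _ => 1
  | .arr _ i => i.cost + 1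
  | .add e f => e.cost + f.cost + 1
  | .sub e f => e.cost + f.cost + 1
  | .half e => e.cost + 1

/-- The value of a real expression (with the convention `x / 0 = 0`). -/
noncomputable def RExp.eval (σ : Store) : RExp → ℝ
  | .const q => (q : ℝ)
  | .reg x => σ.rreg x
  | .arr a i => σ.rarr a (i.eval σ)
  | .cast e => (e.eval σ : ℝ)
  | .add e f => e.eval σ + f.eval σ
  | .sub e f => e.eval σ - f.eval σ
  | .mul e f => e.eval σ * f.eval σ
  | .div e f => e.eval σ / f.eval σ

/-- The number of steps taken to evaluate a real expression. -/
def RExp.cost : RExp → ℕ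
  | .const _ => 1
  | .reg _ => 1
  | .arr _ i => i.cost + 1
  | .cast e => e.cost + 1
  | .add e f => e.cost + f.cost + 1
  | .sub e f => e.cost + f.cost + 1
  | .mul e f => e.cost + f.cost + 1
  | .div e f => e.cost + f.cost + 1

/-- The outcome of a test. -/
def BExp.eval (σ : Store) : BExp → Prop
  | .nle e f => e.eval σ ≤ f.eval σ
  | .rle e f => e.eval σ ≤ f.eval σ
  | .not b => ¬ b.eval σ
  | .and b c => b.eval σ ∧ c.eval σ

/-- The number of steps taken to evaluate a test. -/
def BExp.cost : BExp → ℕ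
  | .nle e f => e.cost + f.cost + 1
  | .rle e f => e.cost + f.cost + 1
  | .not b => b.cost + 1
  | .and b c => b.cost + c.cost + 1

/-- `Exec c σ t τ`: the program `c`, started in the memory state `σ`, halts after exactly `t`
steps in the memory state `τ`. -/
inductive Exec : Prog → Store → ℕ → Store → Prop
  | skip (σ : Store) : Exec .skip σ 1 σ
  | setN (x : ℕ) (e : NExp) (σ : Store) :
      Exec (.setN x e) σ (e.cost + 1)
        { σ with nreg := Function.update σ.nreg x (e.eval σ) }
  | setR (x : ℕ) (e : RExp) (σ : Store) :
      Exec (.setR x e) σ (e.cost + 1)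
        { σ with rreg := Function.update σ.rreg x (e.eval σ) }
  | storeN (a : ℕ) (i e : NExp) (σ : Store) :
      Exec (.storeN a i e) σ (i.cost + e.cost + 1)
        { σ with narr := Function.update σ.narr a
                    (Function.update (σ.narr a) (i.eval σ) (e.eval σ)) }
  | storeR (a : ℕ) (i : NExp) (e : RExp) (σ : Store) :
      Exec (.storeR a i e) σ (i.cost + e.cost + 1)
        { σ with rarr := Function.update σ.rarr a
                    (Function.update (σ.rarr a) (i.eval σ) (e.eval σ)) }
  | seq {c d : Prog} {σ τ ρ : Store} {s t : ℕ} :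
      Exec c σ s τ → Exec d τ t ρ → Exec (.seq c d) σ (s + t) ρ
  | iteTrue {b : BExp} {c d : Prog} {σ τ : Store} {t : ℕ} :
      b.eval σ → Exec c σ t τ → Exec (.ite b c d) σ (b.cost + t + 1) τ
  | iteFalse {b : BExp} {c d : Prog} {σ τ : Store} {t : ℕ} :
      ¬ b.eval σ → Exec d σ t τ → Exec (.ite b c d) σ (b.cost + t + 1) τ
  | loopTrue {b : BExp} {c : Prog} {σ τ ρ : Store} {s t : ℕ} :
      b.eval σ → Exec c σ s τ → Exec (.loop b c) τ t ρ →
        Exec (.loop b c) σ (b.cost + s + t + 1) ρ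
  | loopFalse {b : BExp} {c : Prog} {σ : Store} :
      ¬ b.eval σ → Exec (.loop b c) σ (b.cost + 1) σ

/-- The initial memory state on the input `ε₁, ε₂, n, (v₀, y₀), …, (vₙ₋₁, yₙ₋₁)`: the number `n`
is in integer register `0`, the thresholds `ε₁, ε₂` are in real registers `0` and `1`, the
predictions `vᵢ` are in real array `0` and the outcomes `yᵢ ∈ {0, 1}` are in integer array `0`;
everything else is `0`. -/
noncomputable def initStore (ε₁ ε₂ : ℝ) {n : ℕ} (s : Fin n → Sample) : Store where
  nreg x := if x = 0 then n else 0
  rreg x := if x = 0 then ε₁ else if x = 1 then ε₂ else 0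
  narr a i := if h : a = 0 ∧ i < n then (s ⟨i, h.2⟩).2.toNat else 0
  rarr a i := if h : a = 0 ∧ i < n then ((s ⟨i, h.2⟩).1 : ℝ) else 0

/-- On the input `ε₁, ε₂, n, s`, the program `P` halts within `T` steps with the answer `r`;
the answer is left in integer register `0`, as `1` for "yes" and `0` for "no". -/
def AnswersWithin (P : Prog) (ε₁ ε₂ : ℝ) {n : ℕ} (s : Fin n → Sample) (T : ℝ) (r : Bool) : Prop :=
  ∃ (t : ℕ) (τ : Store), Exec P (initStore ε₁ ε₂ s) t τ ∧ (t : ℝ) ≤ T ∧ τ.nreg 0 = r.toNat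

end CalibrationTesting

/-!
The tester rests on a closed-form statistic that determines the lower distance to calibration up to
a factor `2` on either side, which is where the factor `4` in `4 * ε₂ < ε₁` comes from.

Cut `[0,1]` into `n` buckets. For the residual `y - v`, the statistic `stat` is half the absolute
total residual plus the average, over the cuts between neighbouring buckets, of the absolute
residual on the side of the cut away from the middle bucket. Summation by parts
(`integral_resid_mul`) shows that it is the maximum of `𝔼 (y - v) f(v)` over the functions `f` of
the bucket that change by at most `1/n` from one bucket to the next and satisfy `|f| ≤ 1/2` at the
middle; these have `|f| ≤ 1` everywhere.

* `stat ≤ 2 dCE + 1/n` (`stat_le_of_mem_ext`): if `(u, y)` is calibrated then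
  `𝔼 (y - u) f(u) = 0`, and replacing `u` by `v` changes `(y - u) f(u)` by at most
  `2 |u - v| + 1/n`.
* `dCE ≤ 2 stat + 2/n` (`exists_mem_ext_le_stat`): relabel the bucket `j` and outcome `y` at random
  by `k/n`, paying `|k - j| / n` and the calibration error at every label. Such a relabelling
  becomes calibrated when each label moves to the conditional mean of the outcome, at a cost bounded
  by the calibration error (`exists_mem_ext_le`). By the minimax theorem
  (`exists_kernel_le_pure_reply`) the least payment is the expectation of
  `r(j, y) = min_k |k - j| / n + (y - k/n) s_k` for some `s` with values in `[-1, 1]`. The choice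
  `k = j` gives `(j/n) r(j, 1) + (1 - j/n) r(j, 0) ≤ 0`, that is,
  `r(j, y) ≤ (y - j/n) f(j)` for `f(j) = r(j, 1) - r(j, 0)`, and `f` is bounded by `1` and changes
  by at most `2/n` between neighbours. So the payment is at most `2 stat + 1/n`.

As the statistic is a weighted sum, of total weight `3/2`, of absolute values of means of variables
bounded by `1`, the variance bound and Markov's inequality make the empirical statistic
`5/√n`-close to the true one with probability `2/3` (`exists_event_stat_close`); no chaining over
the class of `f` is needed.

The program finds the bucket of every sample by binary search, adds the residuals up bucket by
bucket, and gets all the cut sums from prefix sums, in `O(n log n)` steps (`within_tester`). It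
compares the statistic with `ε₁ / 4 + ε₂`, the midpoint of `2 * ε₂` and `ε₁ / 2`.
-/

open MeasureTheory

namespace CalibrationTesting

/-! ### The bucketed statistic -/

/-- The index of the cell of the grid `0, 1/n, …, (n-1)/n` that contains `v`; the last cell also
contains `1`. -/
noncomputable def bucket (n : ℕ) (v : ℝ) : ℕ := min ⌊v * n⌋₊ (n - 1)

/-- The indicator of `l < j`. -/
def step (l j : ℕ) : ℝ := if l < j then 1 else 0

/-- The residual `y - v` of a sample. -/
def resid (p : Sample) : ℝ := (p.2.toNat : ℝ) - (p.1 : ℝ)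

/-- The residual restricted to the buckets that the cut between `l` and `l + 1` separates from the
middle bucket `n / 2`, with a sign according to the side. -/
noncomputable def cutResid (n l : ℕ) (p : Sample) : ℝ :=
  resid p * (step l (bucket n p.1) - step l (n / 2))

/-- The test statistic, for an averaging functional `E` (the expectation or a sample mean). -/
noncomputable def stat (n : ℕ) (E : (Sample → ℝ) → ℝ) : ℝ :=
  |E resid| / 2 + (∑ l ∈ Finset.range n, |E (cutResid n l)|) / n

lemma sum_step (g : ℕ → ℝ) {n j : ℕ} (hj : j ≤ n) :
    ∑ l ∈ Finset.range n, g l * step l j = ∑ l ∈ Finset.range j, g l := by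
  simp only [step, mul_ite, mul_one, mul_zero]
  rw [← Finset.sum_filter]
  congr 1
  ext l
  simp only [Finset.mem_filter, Finset.mem_range]
  omega

/-- Summation by parts around the index `h`. -/
lemma eq_add_sum_step (f : ℕ → ℝ) {n j h : ℕ} (hj : j ≤ n) (hh : h ≤ n) :
    f j = f h + ∑ l ∈ Finset.range n, (f (l + 1) - f l) * (step l j - step l h) := by
  simp only [mul_sub (f _ - f _)]
  rw [Finset.sum_sub_distrib, sum_step (fun l => f (l + 1) - f l) hj,
    sum_step (fun l => f (l + 1) - f l) hh,
    Finset.sum_range_sub, Finset.sum_range_sub]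
  ring

lemma bucket_lt {n : ℕ} (hn : 0 < n) (v : ℝ) : bucket n v < n := by
  unfold bucket
  omega

lemma bucket_le_mul {n : ℕ} {v : ℝ} (hv : 0 ≤ v) : (bucket n v : ℝ) ≤ v * n := by
  refine le_trans ?_ (Nat.floor_le (by positivity : 0 ≤ v * n))
  exact_mod_cast min_le_left _ _

lemma mul_le_bucket {n : ℕ} (hn : 0 < n) {v : ℝ} (hv : v ≤ 1) : v * n ≤ bucket n v + 1 := by
  unfold bucket
  rcases le_total ⌊v * n⌋₊ (n - 1) with h | h
  · rw [min_eq_left h]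
    exact (Nat.lt_floor_add_one _).le
  · rw [min_eq_right h]
    have : ((n - 1 : ℕ) : ℝ) + 1 = n := by
      rw [Nat.cast_sub hn]; simp
    rw [this]
    have : (0 : ℝ) ≤ n := by positivity
    nlinarith

lemma abs_sub_bucket_le {n : ℕ} (hn : 0 < n) (v : unitInterval) :
    |(v : ℝ) - bucket n v / n| ≤ 1 / n := by
  have h1 := bucket_le_mul (n := n) v.2.1
  have h2 := mul_le_bucket hn v.2.2
  have hn' : (0 : ℝ) < n := by exact_mod_cast hn
  rw [abs_le]
  constructor
  · have : (bucket n v : ℝ) / n ≤ v := by rwa [div_le_iff₀ hn']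
    have : (0 : ℝ) ≤ 1 / n := by positivity
    linarith
  · have : (v : ℝ) ≤ (bucket n v + 1) / n := by rwa [le_div_iff₀ hn']
    rw [add_div] at this
    linarith

lemma abs_bucket_sub_bucket_le {n : ℕ} (hn : 0 < n) (u v : unitInterval) :
    |(bucket n u : ℝ) - bucket n v| / n ≤ |(u : ℝ) - v| + 1 / n := by
  have hn' : (0 : ℝ) < n := by exact_mod_cast hn
  have key : |(bucket n u : ℝ) - bucket n v| ≤ |(u : ℝ) - v| * n + 1 := by
    have h1 := bucket_le_mul (n := n) v.2.1
    have h2 := mul_le_bucket hn v.2.2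
    have h3 := bucket_le_mul (n := n) u.2.1
    have h4 := mul_le_bucket hn u.2.2
    have h5 := mul_le_mul_of_nonneg_right (le_abs_self ((u : ℝ) - v)) hn'.le
    have h6 := mul_le_mul_of_nonneg_right (neg_abs_le ((u : ℝ) - v)) hn'.le
    rw [abs_le]
    constructor <;> nlinarith
  rw [div_le_iff₀ hn', add_mul, one_div, inv_mul_cancel₀ hn'.ne']
  exact key

@[fun_prop]
lemma measurable_bucket (n : ℕ) : Measurable (bucket n) := by
  unfold bucket
  exact (Nat.measurable_floor.comp (by fun_prop)).min measurable_const

@[fun_prop]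
lemma measurable_resid : Measurable resid := by
  unfold resid
  have h : Measurable fun b : Bool => (b.toNat : ℝ) := measurable_from_top
  fun_prop

lemma measurable_comp_bucket (n : ℕ) (f : ℕ → ℝ) :
    Measurable fun p : Sample => f (bucket n p.1) :=
  (measurable_from_top (f := f)).comp (by fun_prop)

@[fun_prop]
lemma measurable_cutResid (n l : ℕ) : Measurable (cutResid n l) := by
  unfold cutResid
  exact measurable_resid.mul
    (measurable_comp_bucket n fun j => step l j - step l (n / 2))

lemma abs_resid_le (p : Sample) : |resid p| ≤ 1 := by
  have h0 := p.1.2.1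
  have h1 := p.1.2.2
  rw [resid, abs_le]
  cases p.2 <;> constructor <;> simp <;> linarith

lemma abs_step_sub_le (l i j : ℕ) : |step l i - step l j| ≤ 1 := by
  unfold step
  split_ifs <;> simp

lemma abs_cutResid_le (n l : ℕ) (p : Sample) : |cutResid n l p| ≤ 1 := by
  rw [cutResid, abs_mul]
  exact mul_le_one₀ (abs_resid_le p) (abs_nonneg _) (abs_step_sub_le _ _ _)

lemma integrable_of_abs_le {α : Type*} [MeasurableSpace α] {μ : Measure α} [IsFiniteMeasure μ]
    {f : α → ℝ} (hf : Measurable f) (c : ℝ) (h : ∀ x, |f x| ≤ c) : Integrable f μ :=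
  Integrable.of_bound hf.aestronglyMeasurable c (.of_forall h)

lemma integrable_resid_mul {n : ℕ} (hn : 0 < n) (D : Measure Sample) [IsFiniteMeasure D]
    (f : ℕ → ℝ) : Integrable (fun p => resid p * f (bucket n p.1)) D := by
  refine integrable_of_abs_le (measurable_resid.mul (measurable_comp_bucket n f))
    (∑ j ∈ Finset.range n, |f j|) fun p => ?_
  rw [abs_mul]
  refine (mul_le_of_le_one_left (abs_nonneg _) (abs_resid_le p)).trans ?_
  exact Finset.single_le_sum (f := fun j => |f j|) (fun _ _ => abs_nonneg _)
    (Finset.mem_range.2 (bucket_lt hn _))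

lemma integral_resid_mul {n : ℕ} (hn : 0 < n) (D : Measure Sample) [IsFiniteMeasure D]
    (f : ℕ → ℝ) :
    ∫ p, resid p * f (bucket n p.1) ∂D = f (n / 2) * ∫ p, resid p ∂D +
      ∑ l ∈ Finset.range n, (f (l + 1) - f l) * ∫ p, cutResid n l p ∂D := by
  have h : ∀ p : Sample, resid p * f (bucket n p.1) = f (n / 2) * resid p +
      ∑ l ∈ Finset.range n, (f (l + 1) - f l) * cutResid n l p := fun p => by
    rw [eq_add_sum_step f (bucket_lt hn p.1).le (Nat.div_le_self n 2), mul_add, Finset.mul_sum,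
      mul_comm]
    congr 1
    refine Finset.sum_congr rfl fun l _ => ?_
    rw [cutResid]
    ring
  have hr : Integrable resid D := integrable_of_abs_le measurable_resid 1 abs_resid_le
  have hc : ∀ l, Integrable (cutResid n l) D := fun l =>
    integrable_of_abs_le (measurable_cutResid n l) 1 (abs_cutResid_le n l)
  simp only [h]
  rw [integral_add (hr.const_mul _) (integrable_finsetSum _ fun l _ => (hc l).const_mul _),
    integral_const_mul, integral_finsetSum _ fun l _ => (hc l).const_mul _]
  simp only [integral_const_mul]

/-- Under perfect calibration the residual is orthogonal to every bounded function of the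
prediction. -/
lemma Calibrated.integral_resid_mul_eq_zero {μ : Measure Sample} [IsProbabilityMeasure μ]
    (h : Calibrated μ) {F : unitInterval → ℝ} (hF : Measurable F) (c : ℝ)
    (hc : ∀ u, |F u| ≤ c) : ∫ p, resid p * F p.1 ∂μ = 0 := by
  have hle : MeasurableSpace.comap (Prod.fst : Sample → unitInterval) inferInstance ≤
      (inferInstance : MeasurableSpace Sample) := measurable_fst.comap_le
  have hy : Measurable fun p : Sample => (p.2.toNat : ℝ) :=
    (measurable_from_top (f := fun b : Bool => (b.toNat : ℝ))).comp measurable_snd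
  have hyb : ∀ p : Sample, |(p.2.toNat : ℝ)| ≤ 1 := fun p => by cases p.2 <;> simp
  have hub : ∀ p : Sample, |(p.1 : ℝ)| ≤ 1 := fun p => by
    rw [abs_of_nonneg p.1.2.1]; exact p.1.2.2
  have hFm : StronglyMeasurable[MeasurableSpace.comap (Prod.fst : Sample → unitInterval)
      inferInstance] fun p : Sample => F p.1 :=
    (hF.comp (comap_measurable _)).stronglyMeasurable
  have hFp : Measurable fun p : Sample => F p.1 := hF.comp measurable_fst
  have hup : Measurable fun p : Sample => (p.1 : ℝ) := by fun_prop
  have hb : ∀ {a b : ℝ}, |a| ≤ 1 → |b| ≤ c → |a * b| ≤ c := fun {a b} ha hb => by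
    rw [abs_mul]; exact (mul_le_of_le_one_left (abs_nonneg _) ha).trans hb
  have hyF : Integrable (fun p : Sample => (p.2.toNat : ℝ) * F p.1) μ :=
    integrable_of_abs_le (hy.mul hFp) c fun p => hb (hyb p) (hc _)
  have huF : Integrable (fun p : Sample => (p.1 : ℝ) * F p.1) μ :=
    integrable_of_abs_le (hup.mul hFp) c fun p => hb (hub p) (hc _)
  have e1 := condExp_mul_of_stronglyMeasurable_right hFm hyF
    (integrable_of_abs_le hy 1 hyb)
  have e2 : ∫ p, (p.2.toNat : ℝ) * F p.1 ∂μ = ∫ p, (p.1 : ℝ) * F p.1 ∂μ := by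
    rw [← integral_condExp hle]
    refine integral_congr_ae ?_
    filter_upwards [e1, h] with p h1 h2
    have h3 := h1
    simp only [Pi.mul_apply] at h3
    rw [h2] at h3
    exact h3
  simp only [resid, sub_mul]
  rw [integral_sub hyF huF, e2, sub_self]

/-! ### The statistic is at most twice the distance to calibration -/

/-- The statistic is a value `𝔼 (y - v) f(v)` for a function `f` of the bucket that varies by at
most `1/n` between neighbours and is bounded by `1`. -/
lemma exists_stat_eq {n : ℕ} (hn : 0 < n) (D : Measure Sample) [IsFiniteMeasure D] :
    ∃ f : ℕ → ℝ, (∀ j < n, |f j| ≤ 1) ∧ (∀ i j : ℕ, |f i - f j| ≤ |(i : ℝ) - j| / n) ∧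
      stat n (fun g => ∫ p, g p ∂D) = ∫ p, resid p * f (bucket n p.1) ∂D := by
  have hn' : (0 : ℝ) < n := by exact_mod_cast hn
  set T : ℕ → ℝ := fun l => ∫ p, cutResid n l p ∂D with hT
  set W : ℝ := ∫ p, resid p ∂D with hW
  have hsign : ∀ x : ℝ, |(SignType.sign x : ℝ)| ≤ 1 := fun x => by
    rcases lt_trichotomy x 0 with h | h | h <;> simp [h]
  set g : ℕ → ℝ := fun j => ∑ l ∈ Finset.range j, (SignType.sign (T l) : ℝ) / n with hg
  have hlip : ∀ i j : ℕ, i ≤ j → |g j - g i| ≤ ((j : ℝ) - i) / n := fun i j hij => by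
    rw [hg, ← Finset.sum_Ico_eq_sub _ hij]
    refine (Finset.abs_sum_le_sum_abs _ _).trans ?_
    refine (Finset.sum_le_card_nsmul _ _ (1 / (n : ℝ)) fun l _ => ?_).trans ?_
    · rw [abs_div, abs_of_pos hn']
      exact div_le_div_of_nonneg_right (hsign _) hn'.le
    · rw [Nat.card_Ico, nsmul_eq_mul, Nat.cast_sub hij]
      exact (mul_one_div _ _).le
  have hlip' : ∀ i j : ℕ, |g i - g j| ≤ |(i : ℝ) - j| / n := fun i j => by
    rcases le_total i j with h | h
    · rw [abs_sub_comm, abs_sub_comm (i : ℝ),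
        abs_of_nonneg (sub_nonneg.2 (Nat.cast_le.2 h) : (0 : ℝ) ≤ (j : ℝ) - i)]
      exact hlip i j h
    · rw [abs_of_nonneg (sub_nonneg.2 (Nat.cast_le.2 h) : (0 : ℝ) ≤ (i : ℝ) - j)]
      exact hlip j i h
  refine ⟨fun j => (SignType.sign W : ℝ) / 2 + (g j - g (n / 2)), fun j hj => ?_, fun i j => ?_, ?_⟩
  · -- The middle bucket is at distance at most `n / 2` from every other bucket.
    have h1 : |(j : ℝ) - (n / 2 : ℕ)| ≤ n / 2 := by
      have e1 : (j : ℝ) + 1 ≤ n := by exact_mod_cast hj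
      have e2 : (n : ℝ) ≤ 2 * (n / 2 : ℕ) + 1 := by exact_mod_cast (by omega : n ≤ 2 * (n / 2) + 1)
      have e3 : 2 * ((n / 2 : ℕ) : ℝ) ≤ n := by exact_mod_cast (by omega : 2 * (n / 2) ≤ n)
      have e4 : (0 : ℝ) ≤ j := by positivity
      rw [abs_le]
      constructor <;> linarith
    have h2 : |(j : ℝ) - (n / 2 : ℕ)| / n ≤ 1 / 2 := by
      rw [div_le_div_iff₀ hn' two_pos]; linarith
    have h3 : |(SignType.sign W : ℝ) / 2| ≤ 1 / 2 := by
      rw [abs_div, abs_two]; linarith [hsign W]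
    refine (abs_add_le _ _).trans ?_
    linarith [hlip' j (n / 2)]
  · simpa using hlip' i j
  · have habs : ∀ x : ℝ, |x| = SignType.sign x * x := fun x => (sign_mul_self x).symm
    refine Eq.trans ?_ (integral_resid_mul hn D fun j =>
      (SignType.sign W : ℝ) / 2 + (g j - g (n / 2))).symm
    rw [stat, Finset.sum_div, habs (∫ p, resid p ∂D)]
    simp only [sub_self, add_zero, add_sub_add_left_eq_sub, sub_sub_sub_cancel_right]
    congr 1
    · ring
    · refine Finset.sum_congr rfl fun l _ => ?_
      rw [hg, Finset.sum_range_succ_sub_sum, habs (∫ p, cutResid n l p ∂D)]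
      ring

lemma stat_le_of_mem_ext {n : ℕ} (hn : 0 < n) {D : Measure Sample}
    {Q : Measure (unitInterval × unitInterval × Bool)} (hQ : Q ∈ ext D) :
    stat n (fun g => ∫ p, g p ∂D) ≤ 2 * ∫ q, |(q.1 : ℝ) - (q.2.1 : ℝ)| ∂Q + 1 / n := by
  obtain ⟨hprob, hD, hcal⟩ := hQ
  have hn' : (0 : ℝ) < n := by exact_mod_cast hn
  have m1 : Measurable fun q : unitInterval × unitInterval × Bool => (q.2.1, q.2.2) := by fun_prop
  have m2 : Measurable fun q : unitInterval × unitInterval × Bool => (q.1, q.2.2) := by fun_prop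
  have : IsProbabilityMeasure D := hD ▸ Measure.isProbabilityMeasure_map m1.aemeasurable
  have : IsProbabilityMeasure (Q.map fun q => (q.1, q.2.2)) :=
    Measure.isProbabilityMeasure_map m2.aemeasurable
  obtain ⟨f, hf1, hflip, hstat⟩ := exists_stat_eq hn D
  have mf : Measurable fun p : Sample => resid p * f (bucket n p.1) :=
    measurable_resid.mul (measurable_comp_bucket n f)
  have hfb : ∀ v : unitInterval, |f (bucket n v)| ≤ 1 := fun v => hf1 _ (bucket_lt hn _)
  have mfb : Measurable fun v : unitInterval => f (bucket n v) :=
    (measurable_from_top (f := f)).comp (by fun_prop)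
  have hbd : ∀ p : Sample, |resid p * f (bucket n p.1)| ≤ 1 := fun p => by
    rw [abs_mul]; exact mul_le_one₀ (abs_resid_le p) (abs_nonneg _) (hfb _)
  have e0 := hcal.integral_resid_mul_eq_zero mfb 1 hfb
  rw [integral_map m2.aemeasurable mf.aestronglyMeasurable] at e0
  rw [hstat, ← hD, integral_map m1.aemeasurable mf.aestronglyMeasurable]
  have i1 : Integrable (fun q : unitInterval × unitInterval × Bool =>
      resid (q.2.1, q.2.2) * f (bucket n q.2.1)) Q :=
    integrable_of_abs_le (mf.comp m1) 1 fun q => hbd _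
  have i2 : Integrable (fun q : unitInterval × unitInterval × Bool =>
      resid (q.1, q.2.2) * f (bucket n q.1)) Q :=
    integrable_of_abs_le (mf.comp m2) 1 fun q => hbd (q.1, q.2.2)
  have i3 : Integrable (fun q : unitInterval × unitInterval × Bool =>
      |(q.1 : ℝ) - (q.2.1 : ℝ)|) Q :=
    integrable_of_abs_le (by fun_prop) 1 fun q => by
      rw [abs_abs, abs_le]
      constructor <;> linarith [q.1.2.1, q.1.2.2, q.2.1.2.1, q.2.1.2.2]
  have key : ∀ q : unitInterval × unitInterval × Bool,
      resid (q.2.1, q.2.2) * f (bucket n q.2.1) ≤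
        resid (q.1, q.2.2) * f (bucket n q.1) + (2 * |(q.1 : ℝ) - (q.2.1 : ℝ)| + 1 / n) := by
    rintro ⟨u, v, y⟩
    have h1 : resid (v, y) = resid (u, y) + ((u : ℝ) - v) := by simp only [resid]; ring
    have h2 : ((u : ℝ) - v) * f (bucket n u) ≤ |(u : ℝ) - v| := by
      refine (le_abs_self _).trans ?_
      rw [abs_mul]
      exact mul_le_of_le_one_right (abs_nonneg _) (hfb u)
    have h3 : resid (v, y) * (f (bucket n v) - f (bucket n u)) ≤ |(u : ℝ) - v| + 1 / n := by
      refine (le_abs_self _).trans ?_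
      rw [abs_mul]
      refine (mul_le_of_le_one_left (abs_nonneg _) (abs_resid_le _)).trans ?_
      rw [abs_sub_comm]
      exact (hflip _ _).trans (abs_bucket_sub_bucket_le hn u v)
    have h4 : resid (v, y) * f (bucket n v) = resid (u, y) * f (bucket n u) +
        ((u : ℝ) - v) * f (bucket n u) + resid (v, y) * (f (bucket n v) - f (bucket n u)) := by
      rw [h1]; ring
    simp only
    linarith
  refine (integral_mono i1 (i2.add ((i3.const_mul 2).add (integrable_const _))) key).trans ?_
  rw [integral_add' i2 ((i3.const_mul 2).add (integrable_const _)), e0,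
    integral_add' (i3.const_mul 2) (integrable_const _), integral_const_mul]
  simp

/-! ### The distance to calibration is at most twice the statistic -/

/-- The minimax theorem for the game in which a kernel `a` pays
`∑ x, q x * ∑ k, a x k * (c x k + e x k * s k)` against `s ∈ [-1, 1] ^ κ`: for an optimal kernel
the best reply of `s` gives the absolute values on the left, and against an optimal `s` the pure
reply `π` is optimal at every `x`. -/
lemma exists_kernel_le_pure_reply {ι κ : Type*} [Fintype ι] [Fintype κ] [Nonempty κ]
    (q : ι → ℝ) (c e : ι → κ → ℝ) :
    ∃ (a : ι → κ → ℝ) (s : κ → ℝ) (π : ι → κ), (∀ x, a x ∈ stdSimplex ℝ κ) ∧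
      (∀ k, |s k| ≤ 1) ∧ (∀ x k, c x (π x) + e x (π x) * s (π x) ≤ c x k + e x k * s k) ∧
      ∑ x, q x * ∑ k, a x k * c x k + ∑ k, |∑ x, q x * (a x k * e x k)| ≤
        ∑ x, q x * (c x (π x) + e x (π x) * s (π x)) := by
  classical
  set X : Set (ι → κ → ℝ) := Set.univ.pi fun _ => stdSimplex ℝ κ with hX
  set Y : Set (κ → ℝ) := Set.univ.pi fun _ => Set.Icc (-1) 1 with hY
  set L : (ι → κ → ℝ) → (κ → ℝ) → ℝ :=
    fun a s => ∑ x, q x * ∑ k, a x k * (c x k + e x k * s k) with hL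
  have hpure : ∀ ρ : ι → κ, (fun x => Pi.single (ρ x) 1) ∈ X := fun ρ x _ =>
    single_mem_stdSimplex ℝ (ρ x)
  have cX : Convex ℝ X := convex_pi fun _ _ => convex_stdSimplex ℝ κ
  have cY : Convex ℝ Y := convex_pi fun _ _ => convex_Icc _ _
  have hcomb : ∀ (a a' : ι → κ → ℝ) (s s' : κ → ℝ) (t t' : ℝ), t + t' = 1 →
      L (t • a + t' • a') s = t * L a s + t' * L a' s ∧
      L a (t • s + t' • s') = t * L a s + t' * L a s' := by
    intro a a' s s' t t' ht
    constructor <;> simp only [hL, Finset.mul_sum, ← Finset.sum_add_distrib] <;>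
      refine Finset.sum_congr rfl fun x _ => Finset.sum_congr rfl fun k _ => ?_
    · simp only [Pi.add_apply, Pi.smul_apply, smul_eq_mul]; ring
    · simp only [Pi.add_apply, Pi.smul_apply, smul_eq_mul]
      linear_combination (-(q x * (a x k * c x k))) * ht
  obtain ⟨a, ha, s, hs, hsad⟩ := Sion.exists_isSaddlePointOn (X := X) (Y := Y) (f := L)
    ⟨_, hpure fun _ => Classical.arbitrary κ⟩ cX
    (isCompact_univ_pi fun _ => isCompact_stdSimplex ℝ κ)
    (fun s _ => Continuous.lowerSemicontinuous (by fun_prop) |>.lowerSemicontinuousOn _)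
    (fun s _ => ConvexOn.quasiconvexOn ⟨cX, fun a _ a' _ t t' _ _ ht =>
      ((hcomb a a' s s t t' ht).1).le⟩)
    cY ⟨0, fun _ _ => by simp⟩ (isCompact_univ_pi fun _ => isCompact_Icc)
    (fun a _ => Continuous.upperSemicontinuous (by fun_prop) |>.upperSemicontinuousOn _)
    (fun a _ => ConcaveOn.quasiconcaveOn ⟨cY, fun s _ s' _ t t' _ _ ht =>
      ((hcomb a a s s' t t' ht).2).ge⟩)
  choose π hπ using fun x => Finite.exists_min fun k => c x k + e x k * s k
  refine ⟨a, s, π, fun x => ha x trivial, fun k => abs_le.2 (hs k trivial), hπ, ?_⟩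
  have hreply : (fun k => (SignType.sign (∑ x, q x * (a x k * e x k)) : ℝ)) ∈ Y := fun k _ => by
    rcases lt_trichotomy (∑ x, q x * (a x k * e x k)) 0 with h | h | h <;> simp [h]
  have h := hsad _ (hpure π) _ hreply
  simp only [hL] at h
  refine le_of_eq_of_le ?_ (h.trans_eq ?_)
  · simp only [mul_add, Finset.sum_add_distrib]
    congr 1
    simp only [Finset.mul_sum]
    rw [Finset.sum_comm]
    refine Finset.sum_congr rfl fun k _ => ?_
    rw [← sign_mul_self, Finset.mul_sum]
    exact Finset.sum_congr rfl fun x _ => by ring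
  · refine Finset.sum_congr rfl fun x _ => ?_
    congr 1
    rw [Finset.sum_eq_single (π x)]
    · simp
    · intro k _ hk; simp [Pi.single_eq_of_ne hk]
    · simp

/-- A finite randomized relabelling: from the sample `p`, the label `k` is drawn with probability
`w k p`, and the prediction is moved to `c k`. -/
noncomputable def relabel {κ : Type*} [Fintype κ] (D : Measure Sample) (w : κ → Sample → ℝ)
    (c : κ → unitInterval) : Measure (unitInterval × unitInterval × Bool) :=
  ∑ k, (D.withDensity fun p => ENNReal.ofReal (w k p)).map fun p => (c k, p.1, p.2)

section Relabel

variable {κ : Type*} [Fintype κ] {D : Measure Sample}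
  {w : κ → Sample → ℝ} {c : κ → unitInterval}

lemma integral_relabel [IsFiniteMeasure D] (hw : ∀ k, Measurable (w k)) (hw0 : ∀ k p, 0 ≤ w k p)
    (hw1 : ∀ p, ∑ k, w k p = 1) {G : unitInterval × unitInterval × Bool → ℝ} (hG : Measurable G)
    (b : ℝ) (hb : ∀ q, |G q| ≤ b) :
    ∫ q, G q ∂(relabel D w c) = ∑ k, ∫ p, w k p * G (c k, p.1, p.2) ∂D := by
  have hwle : ∀ k p, w k p ≤ 1 := fun k p => by
    rw [← hw1 p]
    exact Finset.single_le_sum (f := fun k => w k p) (fun k _ => hw0 k p) (Finset.mem_univ k)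
  have hm : ∀ k, Measurable fun p : Sample => (c k, p.1, p.2) := fun k => by fun_prop
  have hfin : ∀ k, IsFiniteMeasure (D.withDensity fun p => ENNReal.ofReal (w k p)) := fun k =>
    isFiniteMeasure_withDensity_ofReal
      (integrable_of_abs_le (hw k) 1 fun p => by rw [abs_of_nonneg (hw0 k p)]; exact hwle k p).2
  rw [relabel, integral_finsetSum_measure fun k _ => integrable_of_abs_le hG b hb]
  refine Finset.sum_congr rfl fun k _ => ?_
  rw [integral_map (hm k).aemeasurable hG.aestronglyMeasurable,
    integral_withDensity_eq_integral_toReal_smul (hw k).ennreal_ofReal (by simp)]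
  simp only [ENNReal.toReal_ofReal (hw0 k _), smul_eq_mul]

lemma map_relabel (hw : ∀ k, Measurable (w k)) (hw0 : ∀ k p, 0 ≤ w k p)
    (hw1 : ∀ p, ∑ k, w k p = 1) : (relabel D w c).map (fun q => (q.2.1, q.2.2)) = D := by
  have m1 : Measurable fun q : unitInterval × unitInterval × Bool => (q.2.1, q.2.2) := by fun_prop
  have hm : ∀ k, Measurable fun p : Sample => (c k, p.1, p.2) := fun k => by fun_prop
  ext s hs
  rw [Measure.map_apply m1 hs, relabel, Measure.finsetSum_apply]
  have : ∀ k, ((D.withDensity fun p => ENNReal.ofReal (w k p)).map fun p => (c k, p.1, p.2))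
      ((fun q : unitInterval × unitInterval × Bool => (q.2.1, q.2.2)) ⁻¹' s) =
      ∫⁻ p in s, ENNReal.ofReal (w k p) ∂D := fun k => by
    rw [Measure.map_apply (hm k) (m1 hs), withDensity_apply _ (hm k (m1 hs))]
    rfl
  simp only [this]
  rw [← lintegral_finsetSum _ fun k _ => (hw k).ennreal_ofReal]
  simp only [← ENNReal.ofReal_sum_of_nonneg fun k _ => hw0 k _, hw1]
  simp

lemma isProbabilityMeasure_relabel [IsProbabilityMeasure D]
    (hw : ∀ k, Measurable (w k)) (hw0 : ∀ k p, 0 ≤ w k p)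
    (hw1 : ∀ p, ∑ k, w k p = 1) : IsProbabilityMeasure (relabel D w c) := by
  have m1 : Measurable fun q : unitInterval × unitInterval × Bool => (q.2.1, q.2.2) := by fun_prop
  refine ⟨?_⟩
  rw [← Set.preimage_univ (f := fun q : unitInterval × unitInterval × Bool => (q.2.1, q.2.2)),
    ← Measure.map_apply m1 MeasurableSet.univ, map_relabel hw hw0 hw1, measure_univ]

lemma relabel_mem_ext [IsProbabilityMeasure D]
    (hw : ∀ k, Measurable (w k)) (hw0 : ∀ k p, 0 ≤ w k p)
    (hw1 : ∀ p, ∑ k, w k p = 1)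
    (hc : ∀ k, ∫ p, w k p * ((p.2.toNat : ℝ) - c k) ∂D = 0) : relabel D w c ∈ ext D := by
  have hprob := isProbabilityMeasure_relabel (D := D) (c := c) hw hw0 hw1
  refine ⟨hprob, map_relabel hw hw0 hw1, ?_⟩
  have m2 : Measurable fun q : unitInterval × unitInterval × Bool => (q.1, q.2.2) := by fun_prop
  have : IsProbabilityMeasure ((relabel D w c).map fun q => (q.1, q.2.2)) :=
    Measure.isProbabilityMeasure_map m2.aemeasurable
  have hle : MeasurableSpace.comap (Prod.fst : Sample → unitInterval) inferInstance ≤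
      (inferInstance : MeasurableSpace Sample) := measurable_fst.comap_le
  have hy : Measurable fun p : Sample => (p.2.toNat : ℝ) :=
    (measurable_from_top (f := fun b : Bool => (b.toNat : ℝ))).comp measurable_snd
  have hyb : ∀ p : Sample, |(p.2.toNat : ℝ)| ≤ 1 := fun p => by cases p.2 <;> simp
  have hu : Measurable fun p : Sample => (p.1 : ℝ) := by fun_prop
  have hub : ∀ p : Sample, |(p.1 : ℝ)| ≤ 1 := fun p => by
    rw [abs_of_nonneg p.1.2.1]; exact p.1.2.2
  have iy := integrable_of_abs_le (μ := (relabel D w c).map fun q => (q.1, q.2.2)) hy 1 hyb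
  have iu := integrable_of_abs_le (μ := (relabel D w c).map fun q => (q.1, q.2.2)) hu 1 hub
  refine (ae_eq_condExp_of_forall_setIntegral_eq hle iy (fun _ _ _ => iu.integrableOn) ?_ ?_).symm
  · rintro _ ⟨B, hB, rfl⟩ -
    have hB' : MeasurableSet (Prod.fst ⁻¹' B : Set Sample) := measurable_fst hB
    rw [← sub_eq_zero, ← integral_sub iu.integrableOn iy.integrableOn,
      ← integral_indicator hB']
    have hG : Measurable ((Prod.fst ⁻¹' B : Set Sample).indicator
        fun p => (p.1 : ℝ) - (p.2.toNat : ℝ)) := (hu.sub hy).indicator hB'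
    have hGb : ∀ p, |(Prod.fst ⁻¹' B : Set Sample).indicator
        (fun p => (p.1 : ℝ) - (p.2.toNat : ℝ)) p| ≤ 1 := fun p => by
      by_cases hp : p ∈ (Prod.fst ⁻¹' B : Set Sample)
      · rw [Set.indicator_of_mem hp, abs_sub_comm]; exact abs_resid_le p
      · rw [Set.indicator_of_notMem hp]; simp
    rw [integral_map m2.aemeasurable hG.aestronglyMeasurable]
    refine (integral_relabel hw hw0 hw1 (hG.comp m2) 1 fun q => hGb _).trans ?_
    refine Finset.sum_eq_zero fun k _ => ?_
    by_cases hk : c k ∈ B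
    · rw [← neg_eq_zero, ← integral_neg, ← hc k]
      congr 1
      ext p
      rw [Function.comp_apply,
        Set.indicator_of_mem (show (c k, p.2) ∈ (Prod.fst ⁻¹' B : Set Sample) from hk)]
      ring
    · refine integral_eq_zero_of_ae (.of_forall fun p => ?_)
      simp only [Function.comp_apply]
      rw [Set.indicator_of_notMem (show (c k, p.2) ∉ (Prod.fst ⁻¹' B : Set Sample) from hk)]
      simp
  · exact (Measurable.stronglyMeasurable
      (measurable_subtype_coe.comp (comap_measurable _))).aestronglyMeasurable

/-- Moving a label `g k` to the conditional mean of the outcome makes a relabelling calibrated, at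
the price of the calibration error of the label. -/
lemma exists_mem_ext_le [IsProbabilityMeasure D]
    (hw : ∀ k, Measurable (w k)) (hw0 : ∀ k p, 0 ≤ w k p)
    (hw1 : ∀ p, ∑ k, w k p = 1) (g : κ → ℝ) :
    ∃ Q ∈ ext D, ∫ q, |(q.1 : ℝ) - (q.2.1 : ℝ)| ∂Q ≤
      ∑ k, ∫ p, w k p * |g k - p.1| ∂D + ∑ k, |∫ p, w k p * ((p.2.toNat : ℝ) - g k) ∂D| := by
  have hwle : ∀ k p, w k p ≤ 1 := fun k p => by
    rw [← hw1 p]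
    exact Finset.single_le_sum (f := fun k => w k p) (fun k _ => hw0 k p) (Finset.mem_univ k)
  have hy : Measurable fun p : Sample => (p.2.toNat : ℝ) :=
    (measurable_from_top (f := fun b : Bool => (b.toNat : ℝ))).comp measurable_snd
  have hyb : ∀ p : Sample, |(p.2.toNat : ℝ)| ≤ 1 := fun p => by cases p.2 <;> simp
  have hint : ∀ (k : κ) (G : Sample → ℝ), Measurable G → ∀ b, (∀ p, |G p| ≤ b) →
      Integrable (fun p => w k p * G p) D := fun k G hG b hb =>
    integrable_of_abs_le ((hw k).mul hG) b fun p => by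
      rw [abs_mul, abs_of_nonneg (hw0 k p)]
      exact (mul_le_of_le_one_left (abs_nonneg _) (hwle k p)).trans (hb p)
  have iw : ∀ k, Integrable (w k) D := fun k => by
    simpa using hint k (fun _ => 1) measurable_const 1 (by simp)
  have iwy : ∀ k, Integrable (fun p => w k p * (p.2.toNat : ℝ)) D := fun k => hint k _ hy 1 hyb
  set A : κ → ℝ := fun k => ∫ p, w k p * (p.2.toNat : ℝ) ∂D with hA
  set B : κ → ℝ := fun k => ∫ p, w k p ∂D with hB
  have hA0 : ∀ k, 0 ≤ A k := fun k => integral_nonneg fun p => mul_nonneg (hw0 k p) (by positivity)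
  have hB0 : ∀ k, 0 ≤ B k := fun k => integral_nonneg (hw0 k)
  have hAB : ∀ k, A k ≤ B k := fun k => integral_mono (iwy k) (iw k) fun p =>
    mul_le_of_le_one_right (hw0 k p) ((le_abs_self _).trans (hyb p))
  have hcalib : ∀ (k : κ) (x : ℝ), ∫ p, w k p * ((p.2.toNat : ℝ) - x) ∂D = A k - B k * x :=
    fun k x => by
      simp only [mul_sub]
      rw [integral_sub (iwy k) ((iw k).mul_const x), integral_mul_const]
  set c : κ → unitInterval := fun k =>
    ⟨A k / B k, div_nonneg (hA0 k) (hB0 k), div_le_one_of_le₀ (hAB k) (hB0 k)⟩ with hc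
  -- A label of probability zero has `A k = B k = 0`, so the value of `A k / B k` is irrelevant.
  have hBc : ∀ k, B k * (c k : ℝ) = A k := fun k => by
    rcases (hB0 k).eq_or_lt with h | h
    · rw [← h, zero_mul]; exact le_antisymm (hA0 k) (h ▸ hAB k)
    · exact mul_div_cancel₀ _ h.ne'
  refine ⟨relabel D w c, relabel_mem_ext hw hw0 hw1 fun k => by rw [hcalib, hBc, sub_self], ?_⟩
  rw [integral_relabel hw hw0 hw1 (by fun_prop) 1 fun q => by
      rw [abs_abs, abs_le]
      constructor <;> linarith [q.1.2.1, q.1.2.2, q.2.1.2.1, q.2.1.2.2],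
    ← Finset.sum_add_distrib]
  refine Finset.sum_le_sum fun k _ => ?_
  have hgb : ∀ p : Sample, |(|g k - p.1|)| ≤ |g k| + 1 := fun p => by
    rw [abs_abs]
    refine (abs_sub _ _).trans ?_
    rw [abs_of_nonneg p.1.2.1]
    linarith [p.1.2.2]
  have hcb : ∀ p : Sample, |(|(c k : ℝ) - p.1|)| ≤ 1 := fun p => by
    rw [abs_abs, abs_le]
    constructor <;> linarith [(c k).2.1, (c k).2.2, p.1.2.1, p.1.2.2]
  have i1 := hint k (fun p => |(c k : ℝ) - p.1|) (by fun_prop) 1 hcb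
  have i2 := hint k (fun p => |g k - p.1|) (by fun_prop) _ hgb
  have hle : ∫ p, w k p * |(c k : ℝ) - p.1| ∂D ≤
      ∫ p, (w k p * |g k - p.1| + w k p * |(c k : ℝ) - g k|) ∂D := by
    refine integral_mono i1 (i2.add ((iw k).mul_const _)) fun p => ?_
    simp only
    rw [← mul_add, add_comm]
    exact mul_le_mul_of_nonneg_left (abs_sub_le _ _ _) (hw0 k p)
  refine hle.trans (le_of_eq ?_)
  rw [integral_add i2 ((iw k).mul_const _), integral_mul_const, hcalib, ← hBc k, ← mul_sub,
    abs_mul, abs_of_nonneg (hB0 k)]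

end Relabel

/-- The difference of an optimal reply at the two outcomes is a Lipschitz witness of
miscalibration. -/
lemma reply_le_mul_sub {n : ℕ} {s : Fin n → ℝ} {r : Fin n → Bool → ℝ} (hs : ∀ k, |s k| ≤ 1)
    (hr : ∀ (j : Fin n) (y : Bool) (k : Fin n),
      r j y ≤ |(k : ℝ) - (j : ℝ)| / n + ((y.toNat : ℝ) - (k : ℝ) / n) * s k)
    (hr' : ∀ j y, ∃ k : Fin n,
      r j y = |(k : ℝ) - (j : ℝ)| / n + ((y.toNat : ℝ) - (k : ℝ) / n) * s k) :
    (∀ j, |r j true - r j false| ≤ 1) ∧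
    (∀ i j, |(r i true - r i false) - (r j true - r j false)| ≤ 2 * (|(i : ℝ) - (j : ℝ)| / n)) ∧
    (∀ j y, r j y ≤ ((y.toNat : ℝ) - (j : ℝ) / n) * (r j true - r j false)) := by
  have hj0 : ∀ j : Fin n, 0 ≤ (j : ℝ) / n := fun j => by positivity
  have hj1 : ∀ j : Fin n, (j : ℝ) / n ≤ 1 := fun j =>
    div_le_one_of_le₀ (by exact_mod_cast j.2.le) (by positivity)
  have hlip : ∀ i j y, r i y ≤ r j y + |(i : ℝ) - (j : ℝ)| / n := fun i j y => by
    obtain ⟨k, hk⟩ := hr' j y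
    have h1 := hr i y k
    have h2 : |(k : ℝ) - (i : ℝ)| / n ≤ |(k : ℝ) - (j : ℝ)| / n + |(i : ℝ) - (j : ℝ)| / n := by
      rw [← add_div, abs_sub_comm (i : ℝ)]
      exact div_le_div_of_nonneg_right (abs_sub_le _ _ _) (by positivity)
    linarith
  have hdiag : ∀ j y, r j y ≤ ((y.toNat : ℝ) - (j : ℝ) / n) * s j := fun j y => by
    simpa using hr j y j
  have hcomb : ∀ j : Fin n,
      (j : ℝ) / n * r j true + (1 - (j : ℝ) / n) * r j false ≤ 0 := fun j => by
    have h1 := mul_le_mul_of_nonneg_left (hdiag j true) (hj0 j)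
    have h2 := mul_le_mul_of_nonneg_left (hdiag j false) (sub_nonneg.2 (hj1 j))
    simp only [Bool.toNat_true, Bool.toNat_false, Nat.cast_one, Nat.cast_zero] at h1 h2
    nlinarith
  have htri : ∀ k j : Fin n, (j : ℝ) / n - (k : ℝ) / n ≤ |(k : ℝ) - (j : ℝ)| / n ∧
      (k : ℝ) / n - (j : ℝ) / n ≤ |(k : ℝ) - (j : ℝ)| / n := fun k j => by
    rw [← sub_div, ← sub_div]
    constructor <;> refine div_le_div_of_nonneg_right ?_ (by positivity)
    · rw [abs_sub_comm]; exact le_abs_self _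
    · exact le_abs_self _
  refine ⟨fun j => ?_, fun i j => ?_, fun j y => ?_⟩
  · have a1 := hdiag j true
    have a0 := hdiag j false
    obtain ⟨k, hk⟩ := hr' j true
    obtain ⟨l, hl⟩ := hr' j false
    simp only [Bool.toNat_true, Bool.toNat_false, Nat.cast_one, Nat.cast_zero] at a1 a0 hk hl
    obtain ⟨sj1, sj2⟩ := abs_le.1 (hs j)
    obtain ⟨sk1, sk2⟩ := abs_le.1 (hs k)
    obtain ⟨sl1, sl2⟩ := abs_le.1 (hs l)
    have t1 := htri k j
    have t2 := htri l j
    have b1 : r j true ≤ 1 - (j : ℝ) / n := by nlinarith [hj0 j, hj1 j]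
    have b2 : r j false ≤ (j : ℝ) / n := by nlinarith [hj0 j, hj1 j]
    have b3 : -(1 - (j : ℝ) / n) ≤ r j true := by nlinarith [hj0 k, hj1 k]
    have b4 : -((j : ℝ) / n) ≤ r j false := by nlinarith [hj0 l, hj1 l]
    rw [abs_le]
    constructor <;> linarith
  · have h1 := hlip i j true
    have h2 := hlip j i true
    have h3 := hlip i j false
    have h4 := hlip j i false
    rw [abs_sub_comm (j : ℝ)] at h2 h4
    rw [abs_le]
    constructor <;> linarith
  · have := hcomb j
    cases y <;> simp only [Bool.toNat_true, Bool.toNat_false, Nat.cast_one, Nat.cast_zero] <;>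
      nlinarith

/-- The bucket and the outcome of a sample. -/
noncomputable def cell {n : ℕ} (hn : 0 < n) (p : Sample) : Fin n × Bool :=
  (⟨bucket n p.1, bucket_lt hn _⟩, p.2)

lemma measurable_cell {n : ℕ} (hn : 0 < n) : Measurable (cell hn) := by
  refine Measurable.prodMk (measurable_to_countable' fun j => ?_) measurable_snd
  have h : Measurable fun p : Sample => bucket n p.1 := by fun_prop
  convert h (measurableSet_singleton (j : ℕ)) using 1
  ext p
  simp [Fin.ext_iff]

lemma integral_comp_cell {n : ℕ} (hn : 0 < n) (D : Measure Sample) [IsFiniteMeasure D]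
    (G : Fin n × Bool → ℝ) :
    ∫ p, G (cell hn p) ∂D = ∑ x, (D.map (cell hn)).real {x} * G x := by
  have : IsFiniteMeasure (D.map (cell hn)) := Measure.isFiniteMeasure_map D _
  rw [← integral_map (measurable_cell hn).aemeasurable
    (measurable_of_finite G).aestronglyMeasurable, integral_fintype (.of_finite)]
  rfl

/-- There is a calibrated relabelling whose cost is at most twice the statistic, up to the width of
the buckets. -/
lemma exists_mem_ext_le_stat {n : ℕ} (hn : 0 < n) (D : Measure Sample) [IsProbabilityMeasure D] :
    ∃ Q ∈ ext D, ∫ q, |(q.1 : ℝ) - (q.2.1 : ℝ)| ∂Q ≤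
      2 * stat n (fun g => ∫ p, g p ∂D) + 2 / n := by
  have hn' : (0 : ℝ) < n := by exact_mod_cast hn
  have : Nonempty (Fin n) := ⟨⟨0, hn⟩⟩
  have : IsProbabilityMeasure (D.map (cell hn)) :=
    Measure.isProbabilityMeasure_map (measurable_cell hn).aemeasurable
  set q : Fin n × Bool → ℝ := fun x => (D.map (cell hn)).real {x} with hq
  have hq1 : ∑ x, q x = 1 := by
    have := integral_comp_cell hn D fun _ => 1
    simp only [mul_one, integral_const, probReal_univ, one_smul] at this
    exact this.symm
  obtain ⟨a, s, π, ha, hs, hπ, hval⟩ := exists_kernel_le_pure_reply q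
    (fun x k : _ => |((k : Fin n) : ℝ) - (x.1 : ℝ)| / n)
    (fun x k => (x.2.toNat : ℝ) - (k : ℝ) / n)
  set r : Fin n → Bool → ℝ := fun j y => |(π (j, y) : ℝ) - (j : ℝ)| / n +
    ((y.toNat : ℝ) - (π (j, y) : ℝ) / n) * s (π (j, y)) with hr
  obtain ⟨hf1, hflip, hfr⟩ := reply_le_mul_sub (r := r) hs (fun j y k => hπ (j, y) k)
    (fun j y => ⟨π (j, y), rfl⟩)
  -- Extend the witness from the buckets to all indices by its last value.
  have hidx : ∀ j, min j (n - 1) < n := fun j => by omega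
  set f : ℕ → ℝ := fun j => r ⟨min j (n - 1), hidx j⟩ true - r ⟨min j (n - 1), hidx j⟩ false with hf
  have hfcell : ∀ p : Sample, f (bucket n p.1) =
      r (cell hn p).1 true - r (cell hn p).1 false := fun p => by
    have : min (bucket n p.1) (n - 1) = bucket n p.1 := by have := bucket_lt hn p.1; omega
    simp only [hf, cell, this]
  have hfb : ∀ j, |f j| ≤ 1 := fun j => hf1 _
  have hstep : ∀ l, |f (l + 1) - f l| ≤ 2 / n := fun l => by
    refine (hflip _ _).trans ?_
    rw [show (2 : ℝ) / n = 2 * (1 / n) by ring]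
    refine mul_le_mul_of_nonneg_left (div_le_div_of_nonneg_right ?_ hn'.le) zero_le_two
    have : min (l + 1) (n - 1) = min l (n - 1) ∨ min (l + 1) (n - 1) = min l (n - 1) + 1 := by
      omega
    rcases this with h | h <;> simp only [h] <;> simp
  -- The value of the game is at most the correlation of the residual with the witness.
  have i1 := integrable_resid_mul hn D f
  have hdual : ∑ x, q x * (|(π x : ℝ) - (x.1 : ℝ)| / n +
      ((x.2.toNat : ℝ) - (π x : ℝ) / n) * s (π x)) ≤
      ∫ p, resid p * f (bucket n p.1) ∂D + 1 / n := by
    have e1 := integral_comp_cell hn D fun x => r x.1 x.2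
    refine (e1.symm.le).trans ?_
    have e2 : ∫ p, resid p * f (bucket n p.1) ∂D + 1 / n =
        ∫ p, (resid p * f (bucket n p.1) + 1 / n) ∂D := by
      rw [integral_add i1 (integrable_const _)]; simp
    rw [e2]
    refine integral_mono ?_ (i1.add (integrable_const _)) fun p => ?_
    · have : Integrable (fun x : Fin n × Bool => r x.1 x.2) (D.map (cell hn)) := .of_finite
      exact this.comp_measurable (measurable_cell hn)
    · have h1 := hfr (cell hn p).1 (cell hn p).2
      rw [← hfcell] at h1
      have h2 : ((p.1 : ℝ) - bucket n p.1 / n) * f (bucket n p.1) ≤ 1 / n := by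
        refine (le_abs_self _).trans ?_
        rw [abs_mul]
        exact (mul_le_of_le_one_right (abs_nonneg _) (hfb _)).trans (abs_sub_bucket_le hn p.1)
      have h3 : (((cell hn p).2.toNat : ℝ) - ((cell hn p).1 : ℝ) / n) * f (bucket n p.1) =
        resid p * f (bucket n p.1) + ((p.1 : ℝ) - bucket n p.1 / n) * f (bucket n p.1) := by
        simp only [cell, resid]; ring
      simp only
      linarith
  have hcorr : ∫ p, resid p * f (bucket n p.1) ∂D ≤ 2 * stat n (fun g => ∫ p, g p ∂D) := by
    rw [integral_resid_mul hn, stat, mul_add, mul_div_cancel₀ _ two_ne_zero, mul_div_left_comm,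
      mul_comm _ (2 / (n : ℝ)), Finset.mul_sum]
    refine add_le_add ((le_abs_self _).trans ?_) (Finset.sum_le_sum fun l _ =>
      (le_abs_self _).trans ?_)
    · rw [abs_mul]; exact mul_le_of_le_one_left (abs_nonneg _) (hfb _)
    · rw [abs_mul]; exact mul_le_mul_of_nonneg_right (hstep l) (abs_nonneg _)
  obtain ⟨Q, hQ, hcost⟩ := exists_mem_ext_le (D := D) (w := fun k p => a (cell hn p) k)
    (fun k => (measurable_of_finite fun x => a x k).comp (measurable_cell hn))
    (fun k p => (ha _).1 k) (fun p => (ha _).2) (fun k : Fin n => (k : ℝ) / n)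
  refine ⟨Q, hQ, hcost.trans ?_⟩
  have hmove : ∑ k : Fin n, ∫ p, a (cell hn p) k * |(k : ℝ) / n - p.1| ∂D ≤
      ∑ x, q x * ∑ k, a x k * (|(k : ℝ) - (x.1 : ℝ)| / n) + 1 / n := by
    have e : ∑ x, q x * ∑ k, a x k * (|(k : ℝ) - (x.1 : ℝ)| / n) + 1 / n =
        ∑ k : Fin n, ∫ p, a (cell hn p) k *
          (|(k : ℝ) - ((cell hn p).1 : ℝ)| / n + 1 / n) ∂D := by
      rw [Finset.sum_congr rfl fun k _ =>
        integral_comp_cell hn D fun x => a x k * (|(k : ℝ) - (x.1 : ℝ)| / n + 1 / n),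
        Finset.sum_comm]
      have : (1 : ℝ) / n = ∑ x, q x * ∑ k, a x k * (1 / n) := by
        simp only [← Finset.sum_mul, (ha _).2, one_mul, hq1]
      conv_lhs => rw [this]
      rw [← Finset.sum_add_distrib]
      refine Finset.sum_congr rfl fun x _ => ?_
      rw [← mul_add, ← Finset.sum_add_distrib, Finset.mul_sum]
      simp only [mul_add]
      rfl
    rw [e]
    have hacell : ∀ k, Measurable fun p => a (cell hn p) k := fun k =>
      (measurable_of_finite fun x => a x k).comp (measurable_cell hn)
    have ha1 : ∀ x k, |a x k| ≤ 1 := fun x k => by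
      rw [abs_of_nonneg ((ha x).1 k), ← (ha x).2]
      exact Finset.single_le_sum (f := fun k => a x k) (fun k _ => (ha x).1 k) (Finset.mem_univ k)
    refine Finset.sum_le_sum fun k _ => integral_mono ?_ ?_ fun p => ?_
    · refine integrable_of_abs_le ((hacell k).mul (by fun_prop)) (|(k : ℝ) / n| + 1) fun p => ?_
      rw [abs_mul, abs_abs]
      refine (mul_le_of_le_one_left (abs_nonneg _) (ha1 _ _)).trans ((abs_sub _ _).trans ?_)
      rw [abs_of_nonneg p.1.2.1]
      linarith [p.1.2.2]
    · have : Integrable (fun x : Fin n × Bool => a x k * (|(k : ℝ) - (x.1 : ℝ)| / n + 1 / n))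
        (D.map (cell hn)) := .of_finite
      exact this.comp_measurable (measurable_cell hn)
    · refine mul_le_mul_of_nonneg_left ?_ ((ha _).1 k)
      have h1 := abs_sub_bucket_le hn p.1
      rw [abs_sub_comm] at h1
      have h2 := abs_sub_le ((k : ℝ) / n) (bucket n p.1 / n) p.1
      have h3 : |(k : ℝ) / n - bucket n p.1 / n| = |(k : ℝ) - (bucket n p.1 : ℝ)| / n := by
        rw [← sub_div, abs_div, abs_of_pos hn']
      simp only [cell]
      linarith
  have hcal : ∑ k : Fin n, |∫ p, a (cell hn p) k * ((p.2.toNat : ℝ) - (k : ℝ) / n) ∂D| =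
      ∑ k : Fin n, |∑ x, q x * (a x k * ((x.2.toNat : ℝ) - (k : ℝ) / n))| :=
    Finset.sum_congr rfl fun k _ => congrArg abs
      (integral_comp_cell hn D fun x => a x k * ((x.2.toNat : ℝ) - (k : ℝ) / n))
  have h2n : (2 : ℝ) / n = 1 / n + 1 / n := by ring
  linarith

/-- The statistic approximates the lower distance to calibration up to a factor `2` on each
side. -/
lemma stat_le_dCE_and_dCE_le_stat {n : ℕ} (hn : 0 < n) (D : Measure Sample)
    [IsProbabilityMeasure D] :
    stat n (fun g => ∫ p, g p ∂D) ≤ 2 * dCE D + 1 / n ∧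
      dCE D ≤ 2 * stat n (fun g => ∫ p, g p ∂D) + 2 / n := by
  obtain ⟨Q, hQ, hle⟩ := exists_mem_ext_le_stat hn D
  constructor
  · have : (stat n (fun g => ∫ p, g p ∂D) - 1 / n) / 2 ≤ dCE D := by
      refine le_csInf (Set.Nonempty.image _ ⟨Q, hQ⟩) ?_
      rintro _ ⟨Q', hQ', rfl⟩
      have := stat_le_of_mem_ext hn hQ'
      simp only
      linarith
    linarith
  · refine (csInf_le ⟨0, ?_⟩ (Set.mem_image_of_mem _ hQ)).trans hle
    rintro _ ⟨Q', -, rfl⟩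
    exact integral_nonneg fun _ => abs_nonneg _

/-! ### Concentration of the statistic -/

/-- The mean of `g` over the sample sequence `s`. -/
noncomputable def sampleMean {n : ℕ} (s : Fin n → Sample) (g : Sample → ℝ) : ℝ :=
  (∑ i, g (s i)) / n

lemma measurable_sampleMean {n : ℕ} {g : Sample → ℝ} (hg : Measurable g) :
    Measurable fun s : Fin n → Sample => sampleMean s g := by
  unfold sampleMean
  fun_prop

lemma integral_abs_sampleMean_sub_le {n : ℕ} (hn : 0 < n) (D : Measure Sample)
    [IsProbabilityMeasure D] {g : Sample → ℝ} (hg : Measurable g) (hg1 : ∀ p, |g p| ≤ 1) :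
    ∫ s, |sampleMean s g - ∫ p, g p ∂D| ∂(Measure.pi fun _ : Fin n => D) ≤ 1 / Real.sqrt n := by
  have hn' : (0 : ℝ) < n := by exact_mod_cast hn
  have hr : 0 < Real.sqrt n := Real.sqrt_pos.2 hn'
  have hrr : Real.sqrt n * Real.sqrt n = n := Real.mul_self_sqrt hn'.le
  set m := ∫ p, g p ∂D with hm
  have hL : MemLp g 2 D := MemLp.of_bound hg.aestronglyMeasurable 1 (.of_forall hg1)
  have hvar : ProbabilityTheory.variance g D ≤ 1 := by
    refine (ProbabilityTheory.variance_le_expectation_sq hg.aestronglyMeasurable).trans ?_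
    have : ∫ p, (g ^ 2) p ∂D ≤ ∫ _, (1 : ℝ) ∂D :=
      integral_mono hL.integrable_sq (integrable_const _) fun p =>
        (sq_le_one_iff_abs_le_one _).2 (hg1 p)
    simpa using this
  have hsum : Measurable fun s : Fin n → Sample => ∑ i, g (s i) := by fun_prop
  have hbd : ∀ s : Fin n → Sample, |∑ i, g (s i)| ≤ n := fun s => by
    refine (Finset.abs_sum_le_sum_abs _ _).trans ?_
    refine (Finset.sum_le_card_nsmul _ _ 1 fun i _ => hg1 _).trans ?_
    simp
  have hmean : ∫ s : Fin n → Sample, ∑ i, g (s i) ∂(Measure.pi fun _ : Fin n => D) = n * m := by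
    rw [integral_finsetSum _ fun i _ => integrable_of_abs_le (by fun_prop) 1 fun s => hg1 _]
    simp only [integral_comp_eval (μ := fun _ : Fin n => D) hg.aestronglyMeasurable]
    simp [hm]
  have hsq : ∫ s : Fin n → Sample, (∑ i, g (s i) - n * m) ^ 2 ∂(Measure.pi fun _ : Fin n => D)
      ≤ n := by
    have h1 := ProbabilityTheory.variance_sum_pi (μ := fun _ : Fin n => D) (X := fun _ => g)
      fun _ => hL
    rw [ProbabilityTheory.variance_eq_integral (by fun_prop)] at h1
    simp only [Finset.sum_apply, hmean] at h1
    rw [h1]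
    refine (Finset.sum_le_card_nsmul _ _ 1 fun i _ => hvar).trans ?_
    simp
  have hmabs : |(n : ℝ) * m| ≤ n := by
    rw [← hmean]
    have := norm_integral_le_of_norm_le_const (μ := Measure.pi fun _ : Fin n => D)
      (f := fun s : Fin n → Sample => ∑ i, g (s i)) (C := n) (.of_forall hbd)
    simpa using this
  have hdiff : ∀ s : Fin n → Sample, |∑ i, g (s i) - n * m| ≤ 2 * n := fun s =>
    (abs_sub _ _).trans (by linarith [hbd s])
  -- `2 |x| √n ≤ x ^ 2 + n` bounds the first moment by the second.
  have hpt : ∀ s : Fin n → Sample, |sampleMean s g - m| ≤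
      (∑ i, g (s i) - n * m) ^ 2 * (1 / (2 * (n * Real.sqrt n))) + 1 / (2 * Real.sqrt n) := by
    intro s
    have e : sampleMean s g - m = (∑ i, g (s i) - n * m) / n := by
      rw [sampleMean, sub_div, mul_div_cancel_left₀ _ hn'.ne']
    rw [e, abs_div, abs_of_pos hn']
    set x := ∑ i, g (s i) - n * m
    have h := sq_nonneg (|x| - Real.sqrt n)
    rw [sub_sq, sq_abs, sq (Real.sqrt n), hrr] at h
    have h2 : |x| / n = (2 * |x| * Real.sqrt n) * (1 / (2 * (n * Real.sqrt n))) := by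
      field_simp
    have h3 : 1 / (2 * Real.sqrt n) = n * (1 / (2 * (n * Real.sqrt n))) := by
      field_simp
    rw [h2, h3, ← add_mul]
    exact mul_le_mul_of_nonneg_right (by linarith) (by positivity)
  have i1 : Integrable (fun s : Fin n → Sample => (∑ i, g (s i) - n * m) ^ 2)
      (Measure.pi fun _ : Fin n => D) :=
    integrable_of_abs_le (by fun_prop) ((2 * n) ^ 2) fun s => by
      rw [abs_pow]
      exact pow_le_pow_left₀ (abs_nonneg _) (hdiff s) 2
  have i2 : Integrable (fun s : Fin n → Sample => |sampleMean s g - m|)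
      (Measure.pi fun _ : Fin n => D) := by
    refine integrable_of_abs_le ((measurable_sampleMean hg).sub_const m).abs 2 fun s => ?_
    have e : sampleMean s g - m = (∑ i, g (s i) - n * m) / n := by
      rw [sampleMean, sub_div, mul_div_cancel_left₀ _ hn'.ne']
    rw [abs_abs, e, abs_div, abs_of_pos hn', div_le_iff₀ hn']
    exact hdiff s
  refine (integral_mono i2 ((i1.mul_const _).add (integrable_const _)) hpt).trans ?_
  rw [integral_add' (i1.mul_const _) (integrable_const _), integral_mul_const]
  simp only [integral_const, probReal_univ, one_smul]
  have h3 : 1 / Real.sqrt n = n * (1 / (2 * (n * Real.sqrt n))) + 1 / (2 * Real.sqrt n) := by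
    field_simp; norm_num
  rw [h3]
  gcongr

/-- With probability at least `2/3` the empirical statistic is `O(1/√n)`-close to the
statistic. -/
lemma exists_event_stat_close {n : ℕ} (hn : 0 < n) (D : Measure Sample)
    [IsProbabilityMeasure D] :
    ∃ E : Set (Fin n → Sample), MeasurableSet E ∧
      2 / 3 ≤ (Measure.pi fun _ : Fin n => D).real E ∧
      ∀ s ∈ E, |stat n (sampleMean s) - stat n (fun g => ∫ p, g p ∂D)| < 5 / Real.sqrt n := by
  have hn' : (0 : ℝ) < n := by exact_mod_cast hn
  have hr : 0 < Real.sqrt n := Real.sqrt_pos.2 hn'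
  set δ : (Sample → ℝ) → (Fin n → Sample) → ℝ := fun g s => |sampleMean s g - ∫ p, g p ∂D| with hδ
  set dev : (Fin n → Sample) → ℝ := fun s =>
    δ resid s / 2 + (∑ l ∈ Finset.range n, δ (cutResid n l) s) / n with hdev
  have hδm : ∀ {g : Sample → ℝ}, Measurable g → Measurable (δ g) := fun hg =>
    ((measurable_sampleMean hg).sub_const _).abs
  have hδi : ∀ {g : Sample → ℝ}, Measurable g → (∀ p, |g p| ≤ 1) →
      Integrable (δ g) (Measure.pi fun _ : Fin n => D) := fun {g} hg hg1 => by
    refine integrable_of_abs_le (hδm hg) (1 + |∫ p, g p ∂D|) fun s => ?_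
    rw [hδ, abs_abs]
    refine (abs_sub _ _).trans (add_le_add_left ?_ _)
    rw [sampleMean, abs_div, abs_of_pos hn', div_le_one hn']
    refine (Finset.abs_sum_le_sum_abs _ _).trans ?_
    refine (Finset.sum_le_card_nsmul _ _ 1 fun i _ => hg1 _).trans ?_
    simp
  have i1 := hδi measurable_resid abs_resid_le
  have i2 := fun l => hδi (measurable_cutResid n l) (abs_cutResid_le n l)
  have hdm : Measurable dev := by
    refine ((hδm measurable_resid).div_const 2).add (Measurable.div_const ?_ _)
    exact Finset.measurable_fun_sum _ fun l _ => hδm (measurable_cutResid n l)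
  have i3 : Integrable (fun s => ∑ l ∈ Finset.range n, δ (cutResid n l) s)
      (Measure.pi fun _ : Fin n => D) := integrable_finsetSum _ fun l _ => i2 l
  have hdi : Integrable dev (Measure.pi fun _ : Fin n => D) := (i1.div_const 2).add (i3.div_const _)
  have hint : ∫ s, dev s ∂(Measure.pi fun _ : Fin n => D) ≤ 3 / 2 * (1 / Real.sqrt n) := by
    rw [hdev, integral_add (i1.div_const 2) (i3.div_const _), integral_div, integral_div,
      integral_finsetSum _ fun l _ => i2 l]
    have h1 := integral_abs_sampleMean_sub_le hn D measurable_resid abs_resid_le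
    have h2 : (∑ l ∈ Finset.range n, ∫ s, δ (cutResid n l) s ∂(Measure.pi fun _ : Fin n => D)) / n
        ≤ 1 / Real.sqrt n := by
      rw [div_le_iff₀ hn']
      refine (Finset.sum_le_card_nsmul _ _ (1 / Real.sqrt n) fun l _ =>
        integral_abs_sampleMean_sub_le hn D (measurable_cutResid n l) (abs_cutResid_le n l)).trans ?_
      rw [Finset.card_range, nsmul_eq_mul, mul_comm]
    linarith
  have hmarkov := mul_meas_ge_le_integral_of_nonneg (μ := Measure.pi fun _ : Fin n => D) (f := dev)
    (.of_forall fun s => by positivity) hdi (5 / Real.sqrt n)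
  have hE : MeasurableSet {s | 5 / Real.sqrt n ≤ dev s} := measurableSet_le measurable_const hdm
  refine ⟨{s | 5 / Real.sqrt n ≤ dev s}ᶜ, hE.compl, ?_, fun s hs => ?_⟩
  · rw [probReal_compl_eq_one_sub hE]
    have h := hmarkov.trans hint
    have e : 5 / Real.sqrt n = 5 * (1 / Real.sqrt n) := by ring
    have hp : 0 < 1 / Real.sqrt n := by positivity
    have h2 : 5 * (Measure.pi fun _ : Fin n => D).real {s | 5 / Real.sqrt n ≤ dev s} ≤ 3 / 2 := by
      refine le_of_mul_le_mul_right ?_ hp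
      calc _ = 5 / Real.sqrt n *
            (Measure.pi fun _ : Fin n => D).real {s | 5 / Real.sqrt n ≤ dev s} := by ring
        _ ≤ _ := h
    linarith
  · refine lt_of_le_of_lt ?_ (not_le.1 hs)
    have e : stat n (sampleMean s) - stat n (fun g => ∫ p, g p ∂D) =
        (|sampleMean s resid| - |∫ p, resid p ∂D|) / 2 +
        (∑ l ∈ Finset.range n, (|sampleMean s (cutResid n l)| - |∫ p, cutResid n l p ∂D|)) / n := by
      rw [stat, stat, Finset.sum_sub_distrib]; ring
    rw [e]
    refine (abs_add_le _ _).trans (add_le_add ?_ ?_)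
    · rw [abs_div, abs_two]
      exact div_le_div_of_nonneg_right (abs_abs_sub_abs_le_abs_sub _ _) zero_le_two
    · rw [abs_div, abs_of_pos hn']
      refine div_le_div_of_nonneg_right ((Finset.abs_sum_le_sum_abs _ _).trans ?_) hn'.le
      exact Finset.sum_le_sum fun l _ => abs_abs_sub_abs_le_abs_sub _ _

/-! ### Reasoning about programs -/

/-- Total correctness with a time bound: the program `c`, started in `σ`, halts within `T` steps
in a state that satisfies `Q`. -/
def Within (c : Prog) (σ : Store) (T : ℕ) (Q : Store → Prop) : Prop :=
  ∃ (t : ℕ) (τ : Store), Exec c σ t τ ∧ t ≤ T ∧ Q τ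

lemma Within.mono {c : Prog} {σ : Store} {S T : ℕ} {Q R : Store → Prop} (h : Within c σ S Q)
    (hST : S ≤ T) (hQR : ∀ τ, Q τ → R τ) : Within c σ T R := by
  obtain ⟨t, τ, hE, ht, hQ⟩ := h
  exact ⟨t, τ, hE, ht.trans hST, hQR τ hQ⟩

lemma Within.setN {x : ℕ} {e : NExp} {σ : Store} {Q : Store → Prop}
    (h : Q { σ with nreg := Function.update σ.nreg x (e.eval σ) }) :
    Within (.setN x e) σ (e.cost + 1) Q :=
  ⟨_, _, .setN x e σ, le_rfl, h⟩

lemma Within.setR {x : ℕ} {e : RExp} {σ : Store} {Q : Store → Prop}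
    (h : Q { σ with rreg := Function.update σ.rreg x (e.eval σ) }) :
    Within (.setR x e) σ (e.cost + 1) Q :=
  ⟨_, _, .setR x e σ, le_rfl, h⟩

lemma Within.storeR {a : ℕ} {i : NExp} {e : RExp} {σ : Store} {Q : Store → Prop}
    (h : Q { σ with
      rarr := Function.update σ.rarr a
        (Function.update (σ.rarr a) (i.eval σ) (e.eval σ)) }) :
    Within (.storeR a i e) σ (i.cost + e.cost + 1) Q :=
  ⟨_, _, .storeR a i e σ, le_rfl, h⟩

lemma Within.seq {c d : Prog} {σ : Store} {S T : ℕ} {Q R : Store → Prop} (h : Within c σ S R)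
    (h' : ∀ τ, R τ → Within d τ T Q) : Within (.seq c d) σ (S + T) Q := by
  obtain ⟨s, τ, hE, hs, hR⟩ := h
  obtain ⟨t, ρ, hE', ht, hQ⟩ := h' τ hR
  exact ⟨s + t, ρ, .seq hE hE', add_le_add hs ht, hQ⟩

lemma Within.ite {b : BExp} {c d : Prog} {σ : Store} {T : ℕ} {Q : Store → Prop}
    (h : b.eval σ → Within c σ T Q) (h' : ¬ b.eval σ → Within d σ T Q) :
    Within (.ite b c d) σ (b.cost + T + 1) Q := by
  by_cases hb : b.eval σ
  · obtain ⟨t, τ, hE, ht, hQ⟩ := h hb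
    exact ⟨_, τ, .iteTrue hb hE, by omega, hQ⟩
  · obtain ⟨t, τ, hE, ht, hQ⟩ := h' hb
    exact ⟨_, τ, .iteFalse hb hE, by omega, hQ⟩

/-- The rule for loops: `P k` is the invariant together with the promise of at most `k` further
passes. -/
lemma Within.loop {b : BExp} {c : Prog} {T : ℕ} (P : ℕ → Store → Prop)
    (h0 : ∀ σ, P 0 σ → ¬ b.eval σ)
    (hs : ∀ k σ, P (k + 1) σ → b.eval σ → Within c σ T (P k)) (k : ℕ) :
    ∀ σ, P k σ → Within (.loop b c) σ (k * (b.cost + T + 1) + (b.cost + 1))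
      fun τ => (∃ j, P j τ) ∧ ¬ b.eval τ := by
  induction k with
  | zero => exact fun σ hσ => ⟨_, σ, .loopFalse (h0 σ hσ), by omega, ⟨0, hσ⟩, h0 σ hσ⟩
  | succ k ih =>
    intro σ hσ
    by_cases hb : b.eval σ
    · obtain ⟨s, τ, hE, ht, hP⟩ := hs k σ hσ hb
      obtain ⟨t, ρ, hE', ht', hQ⟩ := ih τ hP
      refine ⟨_, ρ, .loopTrue hb hE hE', ?_, hQ⟩
      rw [add_mul, one_mul]
      omega
    · refine ⟨_, σ, .loopFalse hb, ?_, ⟨k + 1, hσ⟩, hb⟩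
      rw [add_mul]
      omega

/-- The rule for loops in which register `1` counts up to the number in register `0`. -/
lemma Within.countedLoop {c : Prog} {T n : ℕ} (I : ℕ → Store → Prop)
    (hI : ∀ i σ, I i σ → σ.nreg 0 = n ∧ σ.nreg 1 = i)
    (hs : ∀ i σ, i < n → I i σ → Within c σ T (I (i + 1))) {σ : Store} (hσ : I 0 σ) :
    Within (.loop (.nle (.add (.reg 1) (.const 1)) (.reg 0)) c) σ (n * (T + 6) + 6) (I n) := by
  have h := Within.loop (b := .nle (.add (.reg 1) (.const 1)) (.reg 0)) (c := c) (T := T)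
    (fun k τ => ∃ i, i + k = n ∧ I i τ) ?_ ?_ n σ ⟨0, by simp, hσ⟩
  · refine h.mono (by simp only [BExp.cost, NExp.cost]; ring_nf; rfl) ?_
    rintro τ ⟨⟨j, i, hij, hτ⟩, hb⟩
    have := hI i τ hτ
    simp only [BExp.eval, NExp.eval, this.1, this.2] at hb
    rwa [show n = i by omega]
  · rintro τ ⟨i, hi, hτ⟩
    have := hI i τ hτ
    simp only [BExp.eval, NExp.eval, this.1, this.2]
    omega
  · rintro k τ ⟨i, hi, hτ⟩ -
    exact (hs i τ (by omega) hτ).mono le_rfl fun ρ hρ => ⟨i + 1, by omega, hρ⟩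

/-! ### The testing program -/

/-- The midpoint of the registers `2` and `3`. -/
def midpoint : NExp := .half (.add (.reg 2) (.reg 3))

/-- Binary search for the bucket of the prediction with index register `1`. The bucket lies in
the interval from register `2` (inclusive) to register `3` (exclusive). -/
def searchBucket : Prog :=
  .seq (.setN 2 (.const 0)) <| .seq (.setN 3 (.reg 0)) <|
    .loop (.nle (.add (.reg 2) (.const 2)) (.reg 3))
      (.ite (.rle (.div (.cast midpoint) (.cast (.reg 0))) (.arr 0 (.reg 1)))
        (.setN 2 midpoint) (.setN 3 midpoint))

lemma eq_bucket {n lo : ℕ} {v : ℝ} (hn : 0 < n) (hlo : lo < n) (h : (lo : ℝ) / n ≤ v)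
    (h' : lo + 1 = n ∨ v < ((lo + 1 : ℕ) : ℝ) / n) : bucket n v = lo := by
  have hn' : (0 : ℝ) < n := by exact_mod_cast hn
  rw [div_le_iff₀ hn'] at h
  have h1 : lo ≤ ⌊v * n⌋₊ := Nat.le_floor h
  unfold bucket
  rcases h' with h' | h'
  · omega
  · rw [lt_div_iff₀ hn'] at h'
    have h2 : ⌊v * n⌋₊ < lo + 1 := (Nat.floor_lt ((Nat.cast_nonneg lo).trans h)).2 h'
    omega

lemma within_searchBucket {n : ℕ} (hn : 0 < n) {σ : Store} (hσ : σ.nreg 0 = n)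
    (hv : 0 ≤ σ.rarr 0 (σ.nreg 1)) :
    Within searchBucket σ (30 * Nat.log 2 n + 50) fun τ =>
      τ.nreg 0 = n ∧ τ.nreg 1 = σ.nreg 1 ∧ τ.nreg 2 = bucket n (σ.rarr 0 (σ.nreg 1)) ∧
      τ.rreg = σ.rreg ∧ τ.narr = σ.narr ∧ τ.rarr = σ.rarr := by
  set v := σ.rarr 0 (σ.nreg 1) with hvdef
  set P : ℕ → Store → Prop := fun k τ =>
    (τ.nreg 0 = n ∧ τ.nreg 1 = σ.nreg 1 ∧ τ.rreg = σ.rreg ∧ τ.narr = σ.narr ∧ τ.rarr = σ.rarr) ∧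
    τ.nreg 2 < τ.nreg 3 ∧ τ.nreg 3 ≤ n ∧ τ.nreg 3 ≤ τ.nreg 2 + 2 ^ k ∧
    ((τ.nreg 2 : ℕ) : ℝ) / n ≤ v ∧ (τ.nreg 3 = n ∨ v < ((τ.nreg 3 : ℕ) : ℝ) / n) with hP
  have hbody : ∀ k τ, P (k + 1) τ → (BExp.nle (.add (.reg 2) (.const 2)) (.reg 3)).eval τ →
      Within (.ite (.rle (.div (.cast midpoint) (.cast (.reg 0))) (.arr 0 (.reg 1)))
        (.setN 2 midpoint) (.setN 3 midpoint)) τ 17 (P k) := by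
    rintro k τ ⟨⟨h0, h1, hr, hna, hra⟩, hlt, hle, hk, hlo, hhi⟩ hb
    simp only [BExp.eval, NExp.eval] at hb
    rw [pow_succ] at hk
    refine Within.mono (Within.ite (T := 5) (fun hc => ?_) fun hc => ?_) (by decide) fun _ h => h
    · refine (Within.setN (Q := P k) ?_).mono (by decide) fun _ h => h
      simp only [BExp.eval, RExp.eval, midpoint, NExp.eval, h0, h1, hra] at hc
      simp [hP, midpoint, NExp.eval]
      exact ⟨⟨h0, h1, hr, hna, hra⟩, by omega, hle, by omega, hc, hhi⟩
    · refine (Within.setN (Q := P k) ?_).mono (by decide) fun _ h => h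
      simp only [BExp.eval, RExp.eval, midpoint, NExp.eval, h0, h1, hra, not_le] at hc
      simp [hP, midpoint, NExp.eval]
      exact ⟨⟨h0, h1, hr, hna, hra⟩, by omega, by omega, by omega, hlo, .inr hc⟩
  have hzero : ∀ τ, P 0 τ → ¬ (BExp.nle (.add (.reg 2) (.const 2)) (.reg 3)).eval τ := by
    rintro τ ⟨-, -, -, hk, -, -⟩
    simp only [BExp.eval, NExp.eval]
    omega
  have hstart : Within (.seq (.setN 2 (.const 0)) <| .seq (.setN 3 (.reg 0)) <|
      .loop (.nle (.add (.reg 2) (.const 2)) (.reg 3))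
      (.ite (.rle (.div (.cast midpoint) (.cast (.reg 0))) (.arr 0 (.reg 1)))
        (.setN 2 midpoint) (.setN 3 midpoint))) σ
      (2 + (2 + ((Nat.log 2 n + 1) * (5 + 17 + 1) + (5 + 1)))) fun τ =>
        (∃ j, P j τ) ∧ ¬ (BExp.nle (.add (.reg 2) (.const 2)) (.reg 3)).eval τ := by
    refine Within.seq (R := fun τ => τ = { σ with nreg := Function.update σ.nreg 2 0 })
      (Within.setN rfl) ?_
    rintro _ rfl
    refine Within.seq (R := P (Nat.log 2 n + 1)) (Within.setN ?_) fun τ hτ =>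
      Within.loop P hzero hbody _ τ hτ
    have := Nat.lt_pow_succ_log_self one_lt_two n
    simp [hP, NExp.eval, hσ, hn, hv, this.le]
  refine hstart.mono ?_ ?_
  · omega
  · rintro τ ⟨⟨j, ⟨h0, h1, hr, hna, hra⟩, hlt, hle, -, hlo, hhi⟩, hb⟩
    simp only [BExp.eval, NExp.eval] at hb
    have h3 : τ.nreg 3 = τ.nreg 2 + 1 := by omega
    rw [h3] at hhi hle
    exact ⟨h0, h1, (eq_bucket hn (by omega) hlo hhi).symm, hr, hna, hra⟩

/-- Add the residual of the sample with index register `1` to the total in real register `2` and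
to the entry of its bucket in real array `1`. -/
def bucketPass : Prog :=
  .seq searchBucket <|
    .seq (.storeR 1 (.reg 2) (.add (.arr 1 (.reg 2))
      (.sub (.cast (.arr 0 (.reg 1))) (.arr 0 (.reg 1))))) <|
    .seq (.setR 2 (.add (.reg 2) (.sub (.cast (.arr 0 (.reg 1))) (.arr 0 (.reg 1))))) <|
    .setN 1 (.add (.reg 1) (.const 1))

/-- Add the bucket with index register `1` to the prefix sum in real register `3`, and add the
absolute value of the sum over the buckets on the far side of the cut to real register `4`. -/
def cutPass : Prog :=
  .seq (.setR 3 (.add (.reg 3) (.arr 1 (.reg 1)))) <|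
    .seq (.ite (.nle (.add (.reg 1) (.const 1)) (.half (.reg 0)))
      (.setR 5 (.reg 3)) (.setR 5 (.sub (.reg 3) (.reg 2)))) <|
    .seq (.ite (.rle (.const 0) (.reg 5))
      (.setR 4 (.add (.reg 4) (.reg 5))) (.setR 4 (.sub (.reg 4) (.reg 5)))) <|
    .setN 1 (.add (.reg 1) (.const 1))

/-- Add half of `n` times the absolute value of the total residual to real register `4` and
compare the result with `n ^ 2` times the threshold. -/
def decision : Prog :=
  .seq (.ite (.rle (.const 0) (.reg 2))
      (.setR 4 (.add (.reg 4) (.mul (.div (.cast (.reg 0)) (.const 2)) (.reg 2))))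
      (.setR 4 (.sub (.reg 4) (.mul (.div (.cast (.reg 0)) (.const 2)) (.reg 2))))) <|
    .ite (.rle (.reg 4) (.mul (.mul (.add (.div (.reg 0) (.const 4)) (.reg 1))
        (.cast (.reg 0))) (.cast (.reg 0))))
      (.setN 0 (.const 1)) (.setN 0 (.const 0))

/-- The tester: compute the statistic of the samples and compare it with `ε₁ / 4 + ε₂`. -/
def tester : Prog :=
  .seq (.loop (.nle (.add (.reg 1) (.const 1)) (.reg 0)) bucketPass) <|
    .seq (.setN 1 (.const 0)) <|
    .seq (.loop (.nle (.add (.reg 1) (.const 1)) (.reg 0)) cutPass) decision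

/-- The sum of the residuals of the first `i` samples that lie in bucket `j`. -/
noncomputable def bucketSum (n : ℕ) (v : ℕ → ℝ) (y : ℕ → ℕ) (i j : ℕ) : ℝ :=
  ∑ l ∈ Finset.range i, if bucket n (v l) = j then (y l : ℝ) - v l else 0

/-- The sum of the residuals of the first `i` samples. -/
noncomputable def totalSum (v : ℕ → ℝ) (y : ℕ → ℕ) (i : ℕ) : ℝ :=
  ∑ l ∈ Finset.range i, ((y l : ℝ) - v l)

/-- The sum of the residuals of the `n` samples on the side of the cut between the buckets `l`
and `l + 1` that does not contain the middle bucket, up to sign. -/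
noncomputable def cutSum (n : ℕ) (v : ℕ → ℝ) (y : ℕ → ℕ) (l : ℕ) : ℝ :=
  ∑ j ∈ Finset.range (l + 1), bucketSum n v y n j -
    if l + 1 ≤ n / 2 then 0 else totalSum v y n

lemma within_bucketLoop {n : ℕ} (hn : 0 < n) {σ : Store} (hv : ∀ i, 0 ≤ σ.rarr 0 i)
    (h0 : σ.nreg 0 = n) (h1 : σ.nreg 1 = 0) (h2 : σ.rreg 2 = 0) (ha : ∀ j, σ.rarr 1 j = 0) :
    Within (.loop (.nle (.add (.reg 1) (.const 1)) (.reg 0)) bucketPass) σ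
      (n * (30 * Nat.log 2 n + 100) + 6) fun τ =>
      τ.nreg 0 = n ∧ τ.rreg 0 = σ.rreg 0 ∧ τ.rreg 1 = σ.rreg 1 ∧ τ.rreg 3 = σ.rreg 3 ∧
      τ.rreg 4 = σ.rreg 4 ∧ τ.rreg 2 = totalSum (σ.rarr 0) (σ.narr 0) n ∧
      τ.rarr 1 = bucketSum n (σ.rarr 0) (σ.narr 0) n := by
  set I : ℕ → Store → Prop := fun i τ =>
    τ.nreg 0 = n ∧ τ.nreg 1 = i ∧ τ.rreg 0 = σ.rreg 0 ∧ τ.rreg 1 = σ.rreg 1 ∧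
      τ.rreg 3 = σ.rreg 3 ∧ τ.rreg 4 = σ.rreg 4 ∧
      τ.rreg 2 = totalSum (σ.rarr 0) (σ.narr 0) i ∧ τ.narr 0 = σ.narr 0 ∧
      τ.rarr 0 = σ.rarr 0 ∧ τ.rarr 1 = bucketSum n (σ.rarr 0) (σ.narr 0) i with hI
  have h := Within.countedLoop (c := bucketPass) (T := 30 * Nat.log 2 n + 90) (n := n) I
    (fun i τ h => ⟨h.1, h.2.1⟩) ?_ (σ := σ) ?_
  · refine h.mono (by nlinarith) ?_
    rintro τ ⟨t0, -, t1, t2, t3, t4, t5, -, -, t6⟩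
    exact ⟨t0, t1, t2, t3, t4, t5, t6⟩
  · rintro i τ hi ⟨t0, t1, t2, t3, t4, t5, t6, t7, t8, t9⟩
    have hs := within_searchBucket hn t0 (by rw [t8]; exact hv _)
    refine (Within.seq (Q := I (i + 1)) hs (T := 11 + (9 + 4)) ?_).mono (by omega) fun _ h => h
    rintro ρ ⟨r0, r1, r2, rr, rn, ra⟩
    refine Within.seq (R := fun χ => χ = { ρ with
        rarr := Function.update ρ.rarr 1 (bucketSum n (σ.rarr 0) (σ.narr 0) (i + 1)) }) ?_ ?_
    · refine Within.storeR ?_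
      congr 2
      ext j
      simp only [NExp.eval, RExp.eval, r1, r2, rn, ra, t1, t7, t8, t9, bucketSum,
        Finset.sum_range_succ _ i]
      by_cases hj : j = bucket n (σ.rarr 0 i)
      · subst hj; simp
      · rw [Function.update_of_ne hj, if_neg (Ne.symm hj), add_zero]
        rfl
    · rintro _ rfl
      refine Within.seq (R := fun χ => χ.nreg = ρ.nreg ∧
        χ.rreg = Function.update ρ.rreg 2 (totalSum (σ.rarr 0) (σ.narr 0) (i + 1)) ∧
        χ.narr = ρ.narr ∧
        χ.rarr = Function.update ρ.rarr 1 (bucketSum n (σ.rarr 0) (σ.narr 0) (i + 1))) ?_ ?_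
      · refine Within.setR ⟨rfl, ?_, rfl, rfl⟩
        simp only [NExp.eval, RExp.eval, r1, rn, ra, rr, t1, t6, t7, totalSum,
          Finset.sum_range_succ _ i]
        simp [t8]
      · rintro χ ⟨c1, c2, c3, c4⟩
        refine Within.setN ?_
        simp [hI, NExp.eval, c1, c2, c3, c4, r0, r1, rr, rn, ra, t1, t2, t3, t4, t5, t7, t8]
  · refine ⟨h0, h1, rfl, rfl, rfl, rfl, by simp [h2, totalSum], rfl, rfl, ?_⟩
    ext j
    simp [ha, bucketSum]

lemma within_cutLoop {n : ℕ} {σ : Store} {v : ℕ → ℝ} {y : ℕ → ℕ}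
    (h0 : σ.nreg 0 = n) (h1 : σ.nreg 1 = 0) (h2 : σ.rreg 2 = totalSum v y n) (h3 : σ.rreg 3 = 0)
    (h4 : σ.rreg 4 = 0) (ha : σ.rarr 1 = bucketSum n v y n) :
    Within (.loop (.nle (.add (.reg 1) (.const 1)) (.reg 0)) cutPass) σ (n * 100 + 6) fun τ =>
      τ.nreg 0 = n ∧ τ.rreg 0 = σ.rreg 0 ∧ τ.rreg 1 = σ.rreg 1 ∧ τ.rreg 2 = totalSum v y n ∧
      τ.rreg 4 = ∑ l ∈ Finset.range n, |cutSum n v y l| := by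
  set I : ℕ → Store → Prop := fun i τ =>
    τ.nreg 0 = n ∧ τ.nreg 1 = i ∧ τ.rreg 0 = σ.rreg 0 ∧ τ.rreg 1 = σ.rreg 1 ∧
      τ.rreg 2 = totalSum v y n ∧ τ.rreg 3 = ∑ j ∈ Finset.range i, bucketSum n v y n j ∧
      τ.rreg 4 = ∑ l ∈ Finset.range i, |cutSum n v y l| ∧ τ.rarr 1 = bucketSum n v y n with hI
  have h := Within.countedLoop (c := cutPass) (T := 90) (n := n) I
    (fun i τ h => ⟨h.1, h.2.1⟩) ?_ (σ := σ) ?_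
  · refine h.mono (by omega) ?_
    rintro τ ⟨t0, -, t1, t2, t3, -, t4, -⟩
    exact ⟨t0, t1, t2, t3, t4⟩
  · rintro i τ hi ⟨t0, t1, t2, t3, t4, t5, t6, t7⟩
    refine Within.mono (Within.seq (S := 5) (T := 12 + (13 + 4)) (Q := I (i + 1))
      (R := fun ρ => ρ.nreg = τ.nreg ∧ ρ.rarr = τ.rarr ∧ ρ.rreg = Function.update τ.rreg 3
        (∑ j ∈ Finset.range (i + 1), bucketSum n v y n j)) ?_ ?_) (by omega) fun _ h => h
    · refine Within.setR ⟨rfl, rfl, ?_⟩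
      simp [NExp.eval, RExp.eval, t1, t5, t7, Finset.sum_range_succ]
    · rintro ρ ⟨r1, r2, r3⟩
      refine Within.seq (R := fun χ => χ.nreg = τ.nreg ∧ χ.rarr = τ.rarr ∧
        χ.rreg = Function.update (Function.update τ.rreg 3
          (∑ j ∈ Finset.range (i + 1), bucketSum n v y n j)) 5 (cutSum n v y i)) ?_ ?_
      · refine Within.mono (Within.ite (T := 4) (fun hc => ?_) fun hc => ?_) (by decide)
          fun _ h => h
        · refine Within.mono (Within.setR ⟨r1, r2, ?_⟩) (by decide) fun _ h => h
          simp only [BExp.eval, NExp.eval, r1, t0, t1] at hc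
          simp [RExp.eval, r3, cutSum, hc]
        · refine Within.mono (Within.setR ⟨r1, r2, ?_⟩) (by decide) fun _ h => h
          simp only [BExp.eval, NExp.eval, r1, t0, t1] at hc
          simp [RExp.eval, r3, cutSum, hc, t4]
      · rintro χ ⟨c1, c2, c3⟩
        refine Within.seq (R := fun χ' => χ'.nreg = τ.nreg ∧ χ'.rarr = τ.rarr ∧
          χ'.rreg = Function.update (Function.update (Function.update τ.rreg 3
            (∑ j ∈ Finset.range (i + 1), bucketSum n v y n j)) 5 (cutSum n v y i)) 4
            (∑ l ∈ Finset.range (i + 1), |cutSum n v y l|)) ?_ ?_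
        · refine Within.mono (Within.ite (T := 4) (fun hc => ?_) fun hc => ?_) (by decide)
            fun _ h => h
          · refine Within.mono (Within.setR ⟨c1, c2, ?_⟩) (by decide) fun _ h => h
            simp only [BExp.eval, RExp.eval, c3, Function.update_self, Rat.cast_zero] at hc
            simp [RExp.eval, c3, t6, Finset.sum_range_succ, abs_of_nonneg hc]
          · refine Within.mono (Within.setR ⟨c1, c2, ?_⟩) (by decide) fun _ h => h
            simp only [BExp.eval, RExp.eval, c3, Function.update_self, Rat.cast_zero,
              not_le] at hc
            simp [RExp.eval, c3, t6, Finset.sum_range_succ, abs_of_neg hc, sub_eq_add_neg]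
        · rintro ψ ⟨p1, p2, p3⟩
          refine Within.setN ?_
          simp [hI, NExp.eval, p1, p2, p3, t0, t1, t2, t3, t4, t7]
  · exact ⟨h0, h1, rfl, rfl, h2, by simp [h3], by simp [h4], ha⟩

lemma within_decision {n : ℕ} {σ : Store} {W S : ℝ} (h0 : σ.nreg 0 = n) (h2 : σ.rreg 2 = W)
    (h4 : σ.rreg 4 = S) :
    Within decision σ 100 fun τ => τ.nreg 0 =
      (decide (S + (n : ℝ) / 2 * |W| ≤ (σ.rreg 0 / 4 + σ.rreg 1) * n * n)).toNat := by
  refine Within.mono (Within.seq (S := 20) (T := 20) (R := fun τ => τ.nreg = σ.nreg ∧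
    τ.rreg = Function.update σ.rreg 4 (S + (n : ℝ) / 2 * |W|)) ?_ ?_) (by decide) fun _ h => h
  · refine Within.mono (Within.ite (T := 10) (fun hc => ?_) fun hc => ?_) (by decide)
      fun _ h => h
    · refine Within.mono (Within.setR ⟨rfl, ?_⟩) (by decide) fun _ h => h
      simp only [BExp.eval, RExp.eval, h2, Rat.cast_zero] at hc
      simp [RExp.eval, NExp.eval, h0, h2, h4, abs_of_nonneg hc]
    · refine Within.mono (Within.setR ⟨rfl, ?_⟩) (by decide) fun _ h => h
      simp only [BExp.eval, RExp.eval, h2, Rat.cast_zero, not_le] at hc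
      simp [RExp.eval, NExp.eval, h0, h2, h4, abs_of_neg hc, sub_eq_add_neg]
  · rintro τ ⟨r0, r1⟩
    refine Within.mono (Within.ite (T := 2) (fun hc => ?_) fun hc => ?_) (by decide)
      fun _ h => h
    · refine Within.setN ?_
      simp [BExp.eval, RExp.eval, NExp.eval, r0, r1, h0] at hc
      simp [NExp.eval, hc]
    · refine Within.setN ?_
      simp [BExp.eval, RExp.eval, NExp.eval, r0, r1, h0] at hc
      simp [NExp.eval, decide_eq_false (not_le.2 hc)]

section Samples

variable {n : ℕ} (ε₁ ε₂ : ℝ) (s : Fin n → Sample)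

lemma initStore_resid (i : Fin n) :
    ((initStore ε₁ ε₂ s).narr 0 i : ℝ) - (initStore ε₁ ε₂ s).rarr 0 i = resid (s i) := by
  simp [initStore, resid]

lemma totalSum_initStore :
    totalSum ((initStore ε₁ ε₂ s).rarr 0) ((initStore ε₁ ε₂ s).narr 0) n = ∑ i, resid (s i) := by
  rw [totalSum, Finset.sum_range]
  exact Finset.sum_congr rfl fun i _ => initStore_resid ε₁ ε₂ s i

lemma sum_bucketSum_initStore (l : ℕ) :
    ∑ j ∈ Finset.range (l + 1),
      bucketSum n ((initStore ε₁ ε₂ s).rarr 0) ((initStore ε₁ ε₂ s).narr 0) n j =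
    ∑ i, resid (s i) * (1 - step l (bucket n (s i).1)) := by
  simp only [bucketSum]
  rw [Finset.sum_comm, Finset.sum_range]
  refine Finset.sum_congr rfl fun i _ => ?_
  rw [Finset.sum_ite_eq, initStore_resid]
  have : (initStore ε₁ ε₂ s).rarr 0 i = (s i).1 := by simp [initStore]
  rw [this, step]
  simp only [Finset.mem_range]
  split_ifs <;> first | omega | simp

lemma abs_cutSum_initStore (l : ℕ) :
    |cutSum n ((initStore ε₁ ε₂ s).rarr 0) ((initStore ε₁ ε₂ s).narr 0) l| =
      |∑ i, cutResid n l (s i)| := by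
  rw [← abs_neg, cutSum, sum_bucketSum_initStore, totalSum_initStore]
  congr 1
  simp only [cutResid, mul_sub, Finset.sum_sub_distrib]
  rw [← Finset.sum_mul, ← Finset.sum_mul, step.eq_1 l (n / 2)]
  split_ifs <;> first | omega | ring

lemma stat_sampleMean_le_iff (hn : 0 < n) (θ : ℝ) :
    stat n (sampleMean s) ≤ θ ↔
      ∑ l ∈ Finset.range n, |∑ i, cutResid n l (s i)| + (n : ℝ) / 2 * |∑ i, resid (s i)| ≤
        θ * n * n := by
  have hn' : (0 : ℝ) < n := by exact_mod_cast hn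
  have h : stat n (sampleMean s) = (∑ l ∈ Finset.range n, |∑ i, cutResid n l (s i)| +
      (n : ℝ) / 2 * |∑ i, resid (s i)|) / (n * n) := by
    simp only [stat, sampleMean, abs_div, abs_of_pos hn', ← Finset.sum_div]
    field_simp
    ring
  rw [h, div_le_iff₀ (by positivity), mul_assoc]

lemma within_tester (hn : 0 < n) :
    Within tester (initStore ε₁ ε₂ s) (n * (30 * Nat.log 2 n + 200) + 114) fun τ =>
      τ.nreg 0 = (decide (stat n (sampleMean s) ≤ ε₁ / 4 + ε₂)).toNat := by
  have hv : ∀ i, 0 ≤ (initStore ε₁ ε₂ s).rarr 0 i := fun i => by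
    simp only [initStore]
    split_ifs with h
    · exact (s _).1.2.1
    · exact le_rfl
  refine Within.mono (Within.seq (within_bucketLoop hn hv (by simp [initStore])
    (by simp [initStore]) (by simp [initStore]) (by simp [initStore]))
    (T := 2 + ((n * 100 + 6) + 100)) ?_) (le_of_eq (by ring)) fun _ h => h
  rintro τ ⟨t0, t1, t2, t3, t4, t5, t6⟩
  refine Within.seq (R := fun ρ => ρ = { τ with nreg := Function.update τ.nreg 1 0 })
    (Within.setN rfl) ?_
  rintro _ rfl
  refine Within.seq (within_cutLoop (by simpa using t0) (by simp) t5
    (by simp [t3, initStore]) (by simp [t4, initStore]) t6) ?_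
  rintro ρ ⟨r0, r1, r2, r3, r4⟩
  refine (within_decision r0 r3 r4).mono le_rfl fun χ hχ => ?_
  rw [hχ]
  congr 1
  have e1 : ρ.rreg 0 = ε₁ := by rw [r1]; simp [t1, initStore]
  have e2 : ρ.rreg 1 = ε₂ := by rw [r2]; simp [t2, initStore]
  rw [e1, e2, totalSum_initStore, decide_eq_decide, stat_sampleMean_le_iff s hn]
  simp only [abs_cutSum_initStore]

end Samples

/-! ### Correctness of the tester -/

lemma solvesTolerantTesting {ε₁ ε₂ : ℝ} {n : ℕ} (hn : 0 < n) (hgap : 4 * ε₂ < ε₁)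
    (hbig : 1024 * (1 / (ε₁ - 4 * ε₂) ^ 2) ≤ (n : ℝ)) :
    SolvesTolerantTesting ε₁ ε₂ n
      fun s => decide (stat n (sampleMean s) ≤ ε₁ / 4 + ε₂) := by
  intro D hD
  obtain ⟨E, hE, hprob, hclose⟩ := exists_event_stat_close hn D
  obtain ⟨hlow, hup⟩ := stat_le_dCE_and_dCE_le_stat hn D
  have hn' : (0 : ℝ) < n := by exact_mod_cast hn
  have hr : 0 < Real.sqrt n := Real.sqrt_pos.2 hn'
  have hg : 0 < ε₁ - 4 * ε₂ := by linarith
  -- The sampling error and the bucketing error are below the margin `(ε₁ - 4 * ε₂) / 4`.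
  have hsqrt : 32 / (ε₁ - 4 * ε₂) ≤ Real.sqrt n := by
    refine Real.le_sqrt_of_sq_le ?_
    rw [div_pow]
    calc _ = 1024 * (1 / (ε₁ - 4 * ε₂) ^ 2) := by ring
      _ ≤ _ := hbig
  have hsamp : 32 / Real.sqrt n ≤ ε₁ - 4 * ε₂ := by
    rw [div_le_iff₀ hg] at hsqrt
    rw [div_le_iff₀ hr]
    linarith
  have hround : 1 / (n : ℝ) ≤ 1 / Real.sqrt n := by
    refine one_div_le_one_div_of_le hr ?_
    rw [Real.sqrt_le_left hn'.le]
    have : (1 : ℝ) ≤ n := by exact_mod_cast hn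
    nlinarith
  have e1 : 32 / Real.sqrt n = 32 * (1 / Real.sqrt n) := by ring
  have e2 : 5 / Real.sqrt n = 5 * (1 / Real.sqrt n) := by ring
  have e3 : 2 / (n : ℝ) = 2 * (1 / n) := by ring
  have hp : 0 < 1 / Real.sqrt n := by positivity
  refine ⟨E, hE, hprob, fun s hs => ⟨fun h => ?_, fun h => ?_⟩⟩
  · have := (abs_lt.1 (hclose s hs)).1
    rw [decide_eq_false_iff_not, not_le]
    linarith
  · have := (abs_lt.1 (hclose s hs)).2
    rw [decide_eq_true_eq]
    linarith

lemma steps_le {n : ℕ} (hn : 3 ≤ n) :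
    ((n * (30 * Nat.log 2 n + 200) + 114 : ℕ) : ℝ) ≤ 500 * ((n : ℝ) * Real.log n ^ 2) := by
  have hn' : (3 : ℝ) ≤ n := by exact_mod_cast hn
  have h1 : 1 ≤ Real.log n := by
    rw [Real.le_log_iff_exp_le (by linarith)]
    linarith [Real.exp_one_lt_d9]
  have h2 : (Nat.log 2 n : ℝ) ≤ 2 * Real.log n := by
    refine (Real.natLog_le_logb n 2).trans ?_
    rw [Real.logb, div_le_iff₀ (Real.log_pos (by norm_num))]
    have := Real.log_two_gt_d9
    push_cast
    nlinarith
  have h3 : Real.log n ≤ Real.log n ^ 2 := by nlinarith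
  push_cast
  have h4 : (n : ℝ) * (30 * Nat.log 2 n + 200) ≤ n * (260 * Real.log n ^ 2) :=
    mul_le_mul_of_nonneg_left (by nlinarith) (by linarith)
  nlinarith [mul_le_mul hn' (h1.trans h3) zero_le_one (by linarith)]

end CalibrationTesting

theorem theorem3 :
    ∃ C : ℝ, 0 < C ∧ ∃ K : ℝ, 0 < K ∧ ∃ P : CalibrationTesting.Prog,
      ∀ ε₁ ε₂ : ℝ, 0 ≤ ε₂ → ε₂ ≤ ε₁ → ε₁ ≤ 1 → 4 * ε₂ < ε₁ →
        ∀ n : ℕ, C * (1 / (ε₁ - 4 * ε₂) ^ 2) ≤ (n : ℝ) →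
          ∃ A : (Fin n → CalibrationTesting.Sample) → Bool,
            (∀ s : Fin n → CalibrationTesting.Sample,
              CalibrationTesting.AnswersWithin P ε₁ ε₂ s
                (K * ((n : ℝ) * Real.log (n : ℝ) ^ 2)) (A s)) ∧
            CalibrationTesting.SolvesTolerantTesting ε₁ ε₂ n A := by
  refine ⟨1024, by norm_num, 500, by norm_num, CalibrationTesting.tester, ?_⟩
  intro ε₁ ε₂ h0 _ h1 hgap n hn
  have hg : 0 < ε₁ - 4 * ε₂ := by linarith
  have hsq : 1 ≤ 1 / (ε₁ - 4 * ε₂) ^ 2 := by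
    rw [le_div_iff₀ (by positivity), one_mul]
    exact pow_le_one₀ hg.le (by linarith)
  have hn3 : 3 ≤ n := by
    have : (3 : ℝ) ≤ n := by linarith
    exact_mod_cast this
  refine ⟨_, fun s => ?_, CalibrationTesting.solvesTolerantTesting (by omega) hgap hn⟩
  obtain ⟨t, τ, hE, ht, hτ⟩ := CalibrationTesting.within_tester ε₁ ε₂ s (by omega)
  exact ⟨t, τ, hE, (Nat.cast_le.2 ht).trans (CalibrationTesting.steps_le hn3), hτ⟩
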